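/- Let $P$ be a simple polygon in the Euclidean plane and let $\mathcal W\subset\mathbb R^2$ be the closed region it bounds. The \emph{free space} is $\mathcal F=\{x\in\mathbb R^2 : \mathcal D_1(x)\subseteq\mathcal W\}$, where $\mathcal D_r(x)$ is the open disc of radius $r$ around $x$. Given finite sets $S,T\subset\mathcal F$ of start and target positions with $|S|=|T|$, a \emph{solution} of the unlabeled motion-planning problem for unit-disc robots consists of continuous paths $\pi_s:[0,1]\to\mathcal F$, one for each $s\in S$, with $\pi_s(0)=s$, $\{\pi_s(1): s\in S\}=T$, and $\pi_{s'}(\tau)\notin\mathcal D_2(\pi_s(\tau))$ for all $s\neq s'$ and all $\tau\in[0,1]$. The instance has \emph{monochromatic separation} $\mu$ if any two distinct starts are at distance at least $\mu$ and any two distinct targets are at distance at least $\mu$, and \emph{bichromatic separation} $\beta$ if every start is at distance at least $\beta$ from every target. \textbf{Lemma.} For every $\mu<4$ (and whatever bichromatic separation $\beta\in\mathbb R$ is imposed) there are a simple polygon whose free space $\mathcal F$ is a single connected component, and sets $S,T\subset\mathcal F$ of two start and two target positions with monochromatic separation $\mu$ and bichromatic separation $\beta$, such that the unlabeled motion-planning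 problem has no solution. Consequently, a monochromatic separation of $4$ is necessary: if $\mu,\beta\in\mathbb R$ are such that every instance in a simple polygon with a single free space component, with equally many starts and targets, and with monochromatic separation $\mu$ and bichromatic separation $\beta$ has a solution, then $\mu\ge 4$. -/

import Mathlib

namespace MRMP

/-- The Euclidean plane. -/
abbrev Plane : Type := EuclideanSpace ℝ (Fin 2)

/-- A closed polygonal chain `P` is a simple polygon: it has at least three vertices, the vertices
are pairwise distinct, and two different edges meet at most in common end points (so
non-adjacent edges are disjoint, and adjacent ones share only their common vertex).
Edge `i` is the segment from vertex `i` to its cyclic successor `finRotate n i`. -/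
structure IsSimplePolygon {n : ℕ} (P : Polygon Plane n) : Prop where
  three_le : 3 ≤ n
  injective : Function.Injective P.vertices
  edges_inter : ∀ i j : Fin n, i ≠ j →
    P.edgeSet ℝ i ∩ P.edgeSet ℝ j ⊆
      {P.vertices i, P.vertices (finRotate n i)} ∩ {P.vertices j, P.vertices (finRotate n j)}

/-- The points enclosed by the polygon: the union of the bounded connected components of the
complement of its boundary curve. -/
def enclosed {n : ℕ} (P : Polygon Plane n) : Set Plane :=
  {x | x ∉ P.boundary ℝ ∧ Bornology.IsBounded (connectedComponentIn (P.boundary ℝ)ᶜ x)}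

/-- The workspace of a polygon: the closed region that it bounds. -/
def workspace {n : ℕ} (P : Polygon Plane n) : Set Plane :=
  P.boundary ℝ ∪ enclosed P

/-- The obstacle space of a workspace `W` is its complement. -/
def obstacleSpace (W : Set Plane) : Set Plane := Wᶜ

/-- The free space of a workspace `W`: all positions at which an open unit disc does not meet the
obstacle space. -/
def freeSpace (W : Set Plane) : Set Plane :=
  {x | Metric.ball x 1 ∩ obstacleSpace W = ∅}

/-- Any two distinct positions in `Q` are at distance at least `μ`. -/
def Separated (μ : ℝ) (Q : Finset Plane) : Prop :=
  ∀ x ∈ Q, ∀ y ∈ Q, x ≠ y → μ ≤ dist x y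

/-- Monochromatic separation `μ`: any two start positions, and any two target positions, are at
distance at least `μ`. -/
def MonochromaticSeparation (μ : ℝ) (S T : Finset Plane) : Prop :=
  Separated μ S ∧ Separated μ T

/-- Bichromatic separation `β`: any start and any target position are at distance at least `β`. -/
def BichromaticSeparation (β : ℝ) (S T : Finset Plane) : Prop :=
  ∀ s ∈ S, ∀ t ∈ T, β ≤ dist s t

/-- A collision-free motion of unlabeled open unit-disc robots in the free space `F` from the
starts `S` to the targets `T`. There is one robot for each start position; `π s` is its path. -/
structure IsMotionPlan (F : Set Plane) (S T : Finset Plane) (π : S → unitInterval → Plane) :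
    Prop where
  continuous : ∀ s, Continuous (π s)
  mem_free : ∀ s τ, π s τ ∈ F
  start : ∀ s, π s 0 = s
  target : Set.range (fun s => π s 1) = (T : Set Plane)
  no_collision : ∀ s s' : S, s ≠ s' → ∀ τ, π s' τ ∉ Metric.ball (π s τ) 2

/-- The unlabeled motion-planning problem with free space `F`, starts `S`, targets `T` has a
solution. -/
def Solvable (F : Set Plane) (S T : Finset Plane) : Prop :=
  ∃ π : S → unitInterval → Plane, IsMotionPlan F S T π

/-- With monochromatic separation `μ` and bichromatic separation `β`, every instance of the
unlabeled problem in a simple polygon whose free space is a single component, with as many starts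
as targets, has a solution. -/
def SeparationSuffices (μ β : ℝ) : Prop :=
  ∀ (n : ℕ) (P : Polygon Plane n), IsSimplePolygon P → IsConnected (freeSpace (workspace P)) →
    ∀ S T : Finset Plane, (S : Set Plane) ⊆ freeSpace (workspace P) →
      (T : Set Plane) ⊆ freeSpace (workspace P) → S.card = T.card →
      MonochromaticSeparation μ S T → BichromaticSeparation β S T →
      Solvable (freeSpace (workspace P)) S T

end MRMP

/-! The workspace is a flask: a nearly circular chamber on top of a corridor of width 2 whose mouth
lies between the tips `(-1, 0)` and `(1, 0)`. A robot at height at most 0 is squeezed onto the axis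
(`eq_zero_of_mem_free_of_nonpos`), so one at height 0 sits at the origin. Every free position in the
closed upper half plane has norm less than 2 (`sq_add_sq_lt_of_mem_free`). Both starts are in the
chamber and both targets in the corridor, so by the intermediate value theorem, at some time the
lower of two robots has height exactly 0; it is at the origin and the other is closer than 2, a
collision (`not_solvable`).

The starts are `(1 + c, s)` and its mirror image, with `c = cos 2η`, `s = sin 2η`, `η = π / N`. They
have norm `2 cos η` and mutual distance `2 (1 + c)`, which tends to 4 as `N` grows. The inradius `1
+ 2 cos η` just admits them, yet a free point in the upper half plane is within angle `η / 2` of a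
side normal, so its norm is at most `2 cos η / cos (η / 2) < 2`. The bottom of the chamber lies
below the tips, at `s - 1`, to make room for the starts. Deep targets realise any `β`.

It remains to show that the outline is a simple polygon bounding the region
(`isSimplePolygon_outline`, `workspace_outline`) and that the free space is connected
(`isConnected_free`): each chamber position moves to an arc of radius 1 about a tip, and this arc
leads to the origin. -/

namespace MRMP

open Real

/-! ### Coordinates, distances and segments in the plane. -/

/-- The point of the plane with the given coordinates. -/
noncomputable def pt (x y : ℝ) : Plane := !₂[x, y]

@[simp] theorem pt_zero (x y : ℝ) : pt x y 0 = x := by simp [pt]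

@[simp] theorem pt_one (x y : ℝ) : pt x y 1 = y := by simp [pt]

theorem plane_ext {p q : Plane} (h0 : p 0 = q 0) (h1 : p 1 = q 1) : p = q := by
  ext i; fin_cases i <;> assumption

theorem continuous_pt {X : Type*} [TopologicalSpace X] {f g : X → ℝ} (hf : Continuous f)
    (hg : Continuous g) : Continuous fun x => pt (f x) (g x) := by
  unfold pt
  fun_prop

theorem dist_eq_sqrt (p q : Plane) :
    dist p q = √((p 0 - q 0) ^ 2 + (p 1 - q 1) ^ 2) := by
  rw [EuclideanSpace.dist_eq, Fin.sum_univ_two, Real.dist_eq, Real.dist_eq, sq_abs, sq_abs]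

theorem dist_lt_iff {p q : Plane} {r : ℝ} (hr : 0 < r) :
    dist p q < r ↔ (p 0 - q 0) ^ 2 + (p 1 - q 1) ^ 2 < r ^ 2 := by
  rw [dist_eq_sqrt, Real.sqrt_lt' hr]

theorem le_dist_iff {p q : Plane} {r : ℝ} (hr : 0 < r) :
    r ≤ dist p q ↔ r ^ 2 ≤ (p 0 - q 0) ^ 2 + (p 1 - q 1) ^ 2 := by
  rw [← not_lt, dist_lt_iff hr, not_lt]

theorem mem_segment_iff {p a b : Plane} :
    p ∈ segment ℝ a b ↔ ∃ t : ℝ, 0 ≤ t ∧ t ≤ 1 ∧ p 0 = a 0 + t * (b 0 - a 0) ∧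
      p 1 = a 1 + t * (b 1 - a 1) := by
  rw [segment_eq_image']
  constructor
  · rintro ⟨t, ⟨h0, h1⟩, rfl⟩
    exact ⟨t, h0, h1, by simp, by simp⟩
  · rintro ⟨t, h0, h1, hx, hy⟩
    exact ⟨t, ⟨h0, h1⟩, plane_ext (by simp [hx]) (by simp [hy])⟩

/-- A point lies on the segment between two points of a line in direction `(-σ, γ)` as soon as its
coordinate along that direction lies between theirs. -/
theorem mem_segment_of_coord {p a b : Plane} {γ σ r α β : ℝ} (hu : γ ^ 2 + σ ^ 2 = 1)
    (hp : γ * p 0 + σ * p 1 = r) (hα : α ≤ -σ * p 0 + γ * p 1) (hβ : -σ * p 0 + γ * p 1 ≤ β)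
    (ha0 : a 0 = r * γ - α * σ) (ha1 : a 1 = r * σ + α * γ)
    (hb0 : b 0 = r * γ - β * σ) (hb1 : b 1 = r * σ + β * γ) : p ∈ segment ℝ a b := by
  have hx : p 0 = r * γ - (-σ * p 0 + γ * p 1) * σ := by
    rw [← hp]; linear_combination (-p 0) * hu
  have hy : p 1 = r * σ + (-σ * p 0 + γ * p 1) * γ := by
    rw [← hp]; linear_combination (-p 1) * hu
  generalize -σ * p 0 + γ * p 1 = w at *
  rw [mem_segment_iff]
  rcases eq_or_lt_of_le (hα.trans hβ) with h | h
  · have : w = α := by linarith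
    exact ⟨0, le_rfl, zero_le_one, by rw [hx, ha0, this]; ring, by rw [hy, ha1, this]; ring⟩
  · have hne : β - α ≠ 0 := by linarith
    refine ⟨(w - α) / (β - α), by apply div_nonneg <;> linarith,
      by rw [div_le_one] <;> linarith, ?_, ?_⟩
    · rw [hx, ha0, hb0]; field_simp; ring
    · rw [hy, ha1, hb1]; field_simp; ring

/-- A point of the closed upper half plane has polar coordinates with angle in `[0, π]`. -/
theorem exists_polar {x y : ℝ} (hy : 0 ≤ y) :
    ∃ r α : ℝ, 0 ≤ r ∧ 0 ≤ α ∧ α ≤ π ∧ x = r * cos α ∧ y = r * sin α := by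
  refine ⟨‖(⟨x, y⟩ : ℂ)‖, Complex.arg ⟨x, y⟩, norm_nonneg _, Complex.arg_nonneg_iff.2 hy,
    Complex.arg_le_pi _, ?_, ?_⟩
  · exact (Complex.norm_mul_cos_arg ⟨x, y⟩).symm
  · exact (Complex.norm_mul_sin_arg ⟨x, y⟩).symm

/-! ### Dimensions of the flask. -/

/-- Parameters of the counterexample: the number of directions of its nearly circular chamber
and the length of its corridor. -/
structure Flask where
  N : ℕ
  L : ℝ
  hN : 8 ≤ N
  hL : 2 ≤ L

namespace Flask

variable (D : Flask)

/-- The angle between consecutive sides of the chamber. -/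
noncomputable def η : ℝ := π / D.N

/-- The unit vector `(c, s)` is normal to the right slanted wall and leads from the tip `(1, 0)` to
the right start, whose disc therefore touches that wall at the tip. -/
noncomputable def c : ℝ := cos (2 * D.η)

noncomputable def s : ℝ := sin (2 * D.η)

/-- The inradius of the chamber. -/
noncomputable def R : ℝ := 1 + 2 * cos D.η

/-- The height of the bottom of the chamber. -/
noncomputable def h : ℝ := D.s - 1

/-- The abscissa at which the wedge beside the corridor meets the bottom of the chamber. -/
noncomputable def b : ℝ := 1 + D.s * (1 - D.s) / D.c

/-- The coordinate of a point in the normal direction of the `k`-th side of the chamber. -/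
noncomputable def height (k : ℕ) (p : Plane) : ℝ := cos (k * D.η) * p 0 + sin (k * D.η) * p 1

theorem N_pos : (0 : ℝ) < D.N := by have := D.hN; exact_mod_cast (by omega : 0 < D.N)

theorem N_mul_η : D.N * D.η = π := by
  have := D.N_pos
  unfold η; field_simp

theorem η_pos : 0 < D.η := div_pos pi_pos D.N_pos

theorem η_le : D.η ≤ π / 8 := by
  have : (8 : ℝ) ≤ D.N := by exact_mod_cast D.hN
  unfold η
  gcongr

theorem c_sq_add : D.c ^ 2 + D.s ^ 2 = 1 := cos_sq_add_sin_sq _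

theorem s_pos : 0 < D.s := by
  have := D.η_pos; have := D.η_le; have := pi_pos
  exact sin_pos_of_pos_of_lt_pi (by linarith) (by linarith)

theorem c_pos : 0 < D.c := by
  have := D.η_pos; have := D.η_le; have := pi_pos
  exact cos_pos_of_mem_Ioo ⟨by linarith, by linarith⟩

theorem s_le_c : D.s ≤ D.c := by
  have := D.η_pos; have := D.η_le; have := pi_pos
  rw [s, c, ← sin_pi_div_two_sub]
  exact sin_le_sin_of_le_of_le_pi_div_two (by linarith) (by linarith) (by linarith)

theorem s_lt_one : D.s < 1 := by nlinarith [D.c_sq_add, D.c_pos, D.s_pos]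

theorem c_lt_one : D.c < 1 := by nlinarith [D.c_sq_add, D.c_pos, D.s_pos]

theorem cos_η : 1 / 2 < cos D.η ∧ cos D.η < 1 := by
  have h1 := D.c_pos
  have h2 : D.c = 2 * cos D.η ^ 2 - 1 := cos_two_mul _
  have h3 : 0 < cos D.η := by
    have := D.η_pos; have := D.η_le; have := pi_pos
    exact cos_pos_of_mem_Ioo ⟨by linarith, by linarith⟩
  have h4 := D.c_lt_one
  constructor <;> nlinarith

theorem R_gt : 2 < D.R := by have := D.cos_η; unfold R; linarith

theorem b_rel : D.c * (D.b - 1) + D.s * D.h = 0 := by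
  have := D.c_pos.ne'
  unfold b h; field_simp; ring

theorem b_gt : 1 < D.b := by
  have : 0 < D.s * (1 - D.s) / D.c :=
    div_pos (mul_pos D.s_pos (by linarith [D.s_lt_one])) D.c_pos
  unfold b; linarith

theorem b_lt : D.b < D.R := by
  have : D.s * (1 - D.s) / D.c ≤ 1 := by
    rw [div_le_one D.c_pos]
    nlinarith [D.s_le_c, D.s_pos]
  have := D.cos_η
  unfold b R; linarith

theorem h_neg : D.h < 0 := by have := D.s_lt_one; unfold h; linarith

theorem h_gt : -1 < D.h := by have := D.s_pos; unfold h; linarith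

theorem neg_L_lt : -D.L < D.h := by have := D.h_gt; have := D.hL; linarith

theorem sin_nonneg_side {k : ℕ} (hk : k ≤ D.N) : 0 ≤ sin (k * D.η) := by
  have h1 : (k : ℝ) ≤ D.N := by exact_mod_cast hk
  have := D.η_pos
  exact sin_nonneg_of_nonneg_of_le_pi (by positivity) (by rw [← D.N_mul_η]; gcongr)

theorem sin_pos_side {k : ℕ} (h0 : 0 < k) (hk : k < D.N) : 0 < sin (k * D.η) := by
  have h1 : (k : ℝ) < D.N := by exact_mod_cast hk
  have h2 : (0 : ℝ) < k := by exact_mod_cast h0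
  have := D.η_pos
  exact sin_pos_of_pos_of_lt_pi (by positivity) (by rw [← D.N_mul_η]; gcongr)

@[simp] theorem height_zero (p : Plane) : D.height 0 p = p 0 := by simp [height]

@[simp] theorem height_N (p : Plane) : D.height D.N p = -p 0 := by simp [height, N_mul_η]

theorem continuous_height (k : ℕ) : Continuous (D.height k) := by unfold height; fun_prop

/-! ### The region: topology, boundedness and escape rays. -/

/-- The intersection of the half planes that bound the chamber from above. -/
def dome : Set Plane := {p | ∀ k ≤ D.N, D.height k p ≤ D.R}

/-- Left unbounded above, like `basin`; both are stable under moving up, and the dome closes them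
off. -/
noncomputable def corridor : Set Plane := {p | |p 0| ≤ 1 ∧ -D.L ≤ p 1}

/-- The points above the bottom of the chamber and above the wedges beside the corridor. -/
noncomputable def basin : Set Plane := {p | D.h ≤ p 1 ∧ 0 ≤ D.c * (|p 0| - 1) + D.s * p 1}

/-- The closed region of the counterexample. -/
noncomputable def region : Set Plane := D.dome ∩ (D.corridor ∪ D.basin)

theorem isClosed_region : IsClosed D.region := by
  refine IsClosed.inter ?_ (IsClosed.union ?_ ?_)
  · simp only [dome, Set.ofPred_forall]
    exact isClosed_iInter fun k => isClosed_iInter fun _ =>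
      isClosed_le (D.continuous_height k) continuous_const
  · have h1 : IsClosed {p : Plane | |p 0| ≤ 1} := isClosed_le (by fun_prop) (by fun_prop)
    have h2 : IsClosed {p : Plane | -D.L ≤ p 1} := isClosed_le (by fun_prop) (by fun_prop)
    exact h1.inter h2
  · have h1 : IsClosed {p : Plane | D.h ≤ p 1} := isClosed_le (by fun_prop) (by fun_prop)
    have h2 : IsClosed {p : Plane | 0 ≤ D.c * (|p 0| - 1) + D.s * p 1} :=
      isClosed_le (by fun_prop) (by fun_prop)
    exact h1.inter h2

/-- The points of the region at which every constraint is slack. -/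
noncomputable def openRegion : Set Plane :=
  {p | ∀ k ≤ D.N, D.height k p < D.R} ∩ ({p | |p 0| < 1 ∧ -D.L < p 1} ∪
    {p | D.h < p 1 ∧ 0 < D.c * (|p 0| - 1) + D.s * p 1})

theorem isOpen_openRegion : IsOpen D.openRegion := by
  refine IsOpen.inter ?_ (IsOpen.union ?_ ?_)
  · have : {p | ∀ k ≤ D.N, D.height k p < D.R} =
        ⋂ k ∈ Set.Iic D.N, {p | D.height k p < D.R} := by ext; simp
    rw [this]
    exact (Set.finite_Iic D.N).isOpen_biInter fun k _ =>
      isOpen_lt (D.continuous_height k) continuous_const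
  · have h1 : IsOpen {p : Plane | |p 0| < 1} := isOpen_lt (by fun_prop) (by fun_prop)
    have h2 : IsOpen {p : Plane | -D.L < p 1} := isOpen_lt (by fun_prop) (by fun_prop)
    exact h1.inter h2
  · have h1 : IsOpen {p : Plane | D.h < p 1} := isOpen_lt (by fun_prop) (by fun_prop)
    have h2 : IsOpen {p : Plane | 0 < D.c * (|p 0| - 1) + D.s * p 1} :=
      isOpen_lt (by fun_prop) (by fun_prop)
    exact h1.inter h2

theorem openRegion_subset : D.openRegion ⊆ D.region := by
  rintro p ⟨h1, h2⟩
  refine ⟨fun k hk => (h1 k hk).le, ?_⟩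
  rcases h2 with h2 | h2
  · exact Or.inl ⟨h2.1.le, h2.2.le⟩
  · exact Or.inr ⟨h2.1.le, h2.2.le⟩

theorem cos_half_pos : 0 < cos (D.η / 2) := by
  have := D.η_pos; have := D.η_le; have := pi_pos
  exact cos_pos_of_mem_Ioo ⟨by linarith, by linarith⟩

/-- A point of the upper half plane is nearly aligned with one of the side normals. -/
theorem exists_height_ge {p : Plane} (hp : 0 ≤ p 1) :
    ∃ k ≤ D.N, √(p 0 ^ 2 + p 1 ^ 2) * cos (D.η / 2) ≤ D.height k p := by
  obtain ⟨r, α, hr, h0, h1, hx, hy⟩ := exists_polar (x := p 0) hp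
  have hη := D.η_pos
  have hround : |α / D.η - round (α / D.η)| ≤ 1 / 2 := abs_sub_round _
  -- The nearest multiple of `η` is within `η / 2` of the polar angle.
  set m : ℤ := round (α / D.η) with hm
  have hα : α / D.η ≤ D.N := by rw [div_le_iff₀ hη, D.N_mul_η]; exact h1
  have hα0 : 0 ≤ α / D.η := by positivity
  rw [abs_le] at hround
  have hm0 : 0 ≤ m := by
    have : (-1 : ℝ) < m := by linarith
    have : (-1 : ℤ) < m := by exact_mod_cast this
    omega
  have hmN : m ≤ D.N := by
    have : (m : ℝ) < D.N + 1 := by linarith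
    have : m < D.N + 1 := by exact_mod_cast this
    omega
  obtain ⟨k, hk⟩ := Int.eq_ofNat_of_zero_le hm0
  have hkm : (m : ℝ) = k := by rw [hk]; simp
  rw [hkm] at hround
  refine ⟨k, by omega, ?_⟩
  have e1 : p 0 ^ 2 + p 1 ^ 2 = r ^ 2 := by
    rw [hx, hy]; linear_combination r ^ 2 * cos_sq_add_sin_sq α
  have e2 : D.height k p = r * cos (α - k * D.η) := by
    rw [height, hx, hy, cos_sub]; ring
  rw [e1, e2, Real.sqrt_sq hr]
  refine mul_le_mul_of_nonneg_left ?_ hr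
  rw [← cos_abs (α - k * D.η)]
  have : |α - k * D.η| ≤ D.η / 2 := by
    have e3 : α - k * D.η = (α / D.η - k) * D.η := by field_simp
    rw [e3, abs_mul, abs_of_pos hη]
    have : |α / D.η - k| ≤ 1 / 2 := abs_le.2 hround
    nlinarith
  apply cos_le_cos_of_nonneg_of_le_pi (abs_nonneg _) _ this
  have := D.η_le; have := pi_pos; linarith

theorem abs_le_of_mem_dome {p : Plane} (hp : p ∈ D.dome) : |p 0| ≤ D.R := by
  have h1 := hp 0 (Nat.zero_le _)
  have h2 := hp D.N le_rfl
  simp only [height_zero, height_N] at h1 h2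
  exact abs_le.2 ⟨by linarith, h1⟩

theorem isBounded_region : Bornology.IsBounded D.region := by
  refine (Metric.isBounded_iff_subset_closedBall (pt 0 0)).2
    ⟨D.R / cos (D.η / 2) + D.R + D.L, ?_⟩
  rintro p ⟨h1, h2⟩
  have hc := D.cos_half_pos
  have hR := D.R_gt
  have hL := D.hL
  have hd : 0 ≤ D.R / cos (D.η / 2) := by positivity
  rw [Metric.mem_closedBall, dist_eq_sqrt]
  simp only [pt_zero, pt_one, sub_zero]
  rcases le_total 0 (p 1) with hp | hp
  · obtain ⟨k, hk, hk'⟩ := D.exists_height_ge hp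
    have := hk'.trans (h1 k hk)
    rw [← le_div_iff₀ hc] at this
    linarith
  · have hx := D.abs_le_of_mem_dome h1
    have hy : -D.L ≤ p 1 := by
      have := D.neg_L_lt
      rcases h2 with h2 | h2
      · exact h2.2
      · linarith [h2.1]
    have hxx : p 0 ^ 2 ≤ D.R ^ 2 := sq_le_sq' (abs_le.1 hx).1 (abs_le.1 hx).2
    have hyy : p 1 ^ 2 ≤ D.L ^ 2 := by nlinarith
    calc √(p 0 ^ 2 + p 1 ^ 2) ≤ √((D.R + D.L) ^ 2) := Real.sqrt_le_sqrt (by nlinarith)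
      _ = D.R + D.L := Real.sqrt_sq (by linarith)
      _ ≤ _ := by linarith

/-- Every point outside the region starts a ray outside the region. -/
theorem exists_ray {p : Plane} (hp : p ∉ D.region) :
    ∃ d : Plane, d ≠ 0 ∧ ∀ t : ℝ, 0 ≤ t → p + t • d ∉ D.region := by
  by_cases h1 : p ∈ D.dome
  -- Inside the dome, escape straight down: corridor and basin are upward closed, so a lower point
  -- in their union would put `p` there too.
  · refine ⟨pt 0 (-1), fun h => by simpa using congrArg (· 1) h, fun t ht hq => hp ⟨h1, ?_⟩⟩
    have := D.s_pos
    rcases hq.2 with hq | hq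
    · refine Or.inl ?_
      simp only [corridor, Set.mem_ofPred_eq, PiLp.add_apply, PiLp.smul_apply, pt_zero, pt_one,
        smul_eq_mul, mul_zero, add_zero] at hq ⊢
      exact ⟨hq.1, by linarith⟩
    · refine Or.inr ?_
      simp only [basin, Set.mem_ofPred_eq, PiLp.add_apply, PiLp.smul_apply, pt_zero, pt_one,
        smul_eq_mul, mul_zero, add_zero] at hq ⊢
      exact ⟨by linarith, by nlinarith⟩
  · simp only [dome, Set.mem_ofPred_eq, not_forall, not_le] at h1
    obtain ⟨k, hk, hlt⟩ := h1
    -- Outside the dome, escape along the normal of a violated side.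
    have e := cos_sq_add_sin_sq (k * D.η)
    refine ⟨pt (cos (k * D.η)) (sin (k * D.η)), fun h => ?_, fun t ht hq => ?_⟩
    · have h0 := congrArg (· 0) h
      have h1 := congrArg (· 1) h
      simp only [pt_zero, pt_one, PiLp.zero_apply] at h0 h1
      rw [h0, h1] at e
      norm_num at e
    · have := hq.1 k hk
      simp only [height, PiLp.add_apply, PiLp.smul_apply, pt_zero, pt_one, smul_eq_mul]
        at this hlt
      nlinarith

/-! ### The boundary polygon and the sides of the dome. -/

/-- The vertices of the boundary polygon in counterclockwise order. -/
noncomputable def vert (k : ℕ) : Plane :=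
  if k = 0 then pt D.R D.h
  else if k ≤ D.N then
    pt (D.R / cos (D.η / 2) * cos (k * D.η - D.η / 2))
      (D.R / cos (D.η / 2) * sin (k * D.η - D.η / 2))
  else match k - D.N with
    | 1 => pt (-D.R) D.h
    | 2 => pt (-D.b) D.h
    | 3 => pt (-1) 0
    | 4 => pt (-1) (-D.L)
    | 5 => pt 1 (-D.L)
    | 6 => pt 1 0
    | 7 => pt D.b D.h
    | _ => pt D.R D.h

@[simp] theorem vert_zero : D.vert 0 = pt D.R D.h := by simp [vert]

theorem vert_side {k : ℕ} (h0 : k ≠ 0) (hk : k ≤ D.N) : D.vert k =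
    pt (D.R / cos (D.η / 2) * cos (k * D.η - D.η / 2))
      (D.R / cos (D.η / 2) * sin (k * D.η - D.η / 2)) := by simp [vert, h0, hk]

@[simp] theorem vert_add_one : D.vert (D.N + 1) = pt (-D.R) D.h := by simp [vert]
@[simp] theorem vert_add_two : D.vert (D.N + 2) = pt (-D.b) D.h := by simp [vert]
@[simp] theorem vert_add_three : D.vert (D.N + 3) = pt (-1) 0 := by simp [vert]
@[simp] theorem vert_add_four : D.vert (D.N + 4) = pt (-1) (-D.L) := by simp [vert]
@[simp] theorem vert_add_five : D.vert (D.N + 5) = pt 1 (-D.L) := by simp [vert]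
@[simp] theorem vert_add_six : D.vert (D.N + 6) = pt 1 0 := by simp [vert]
@[simp] theorem vert_add_seven : D.vert (D.N + 7) = pt D.b D.h := by simp [vert]
@[simp] theorem vert_add_eight : D.vert (D.N + 8) = pt D.R D.h := by simp [vert]

/-- The polygon that bounds the region. -/
noncomputable def outline : Polygon Plane (D.N + 8) := ⟨fun i => D.vert i⟩

theorem outline_vertices (i : Fin (D.N + 8)) : D.outline.vertices i = D.vert i := rfl

theorem outline_next (i : Fin (D.N + 8)) :
    D.outline.vertices (finRotate (D.N + 8) i) = D.vert (i + 1) := by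
  rw [outline_vertices, coe_finRotate]
  split_ifs with h
  · subst h; simp
  · rfl

theorem outline_edgeSet (i : Fin (D.N + 8)) :
    D.outline.edgeSet ℝ i = segment ℝ (D.vert i) (D.vert (i + 1)) := by
  rw [Polygon.edgeSet, affineSegment_eq_segment, ← outline_next, ← outline_vertices]

theorem height_vert {k : ℕ} (j : ℕ) (h0 : k ≠ 0) (hk : k ≤ D.N) : D.height j (D.vert k) =
    D.R / cos (D.η / 2) * cos (k * D.η - D.η / 2 - j * D.η) := by
  rw [D.vert_side h0 hk, height, pt_zero, pt_one, cos_sub _ (j * D.η)]; ring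

theorem height_self_vert {k : ℕ} (hk : k ≤ D.N) : D.height k (D.vert k) = D.R := by
  rcases eq_or_ne k 0 with rfl | h0
  · simp
  · rw [D.height_vert k h0 hk, show k * D.η - D.η / 2 - k * D.η = -(D.η / 2) by ring, cos_neg,
      div_mul_cancel₀ _ D.cos_half_pos.ne']

theorem height_vert_succ {k : ℕ} (hk : k ≤ D.N) : D.height k (D.vert (k + 1)) = D.R := by
  rcases eq_or_lt_of_le hk with rfl | hk
  · simp
  · rw [D.height_vert k (by omega) hk, Nat.cast_succ,
      show (k + 1) * D.η - D.η / 2 - k * D.η = D.η / 2 by ring,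
      div_mul_cancel₀ _ D.cos_half_pos.ne']

theorem vert_mem_dome {k : ℕ} (hk : k ≤ D.N + 1) : D.vert k ∈ D.dome := by
  intro j hj
  have hR := D.R_gt
  have hs := D.sin_nonneg_side hj
  have hh := D.h_neg
  have c1 := cos_le_one (j * D.η)
  have c2 := neg_one_le_cos (j * D.η)
  rcases eq_or_ne k 0 with rfl | h0
  · simp only [height, vert_zero, pt_zero, pt_one]; nlinarith
  rcases Nat.le_succ_iff.1 hk with hk | rfl
  -- The vertex lies at angle at least `η / 2` from every side normal.
  · rw [D.height_vert j h0 hk, div_mul_eq_mul_div, div_le_iff₀ D.cos_half_pos]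
    refine mul_le_mul_of_nonneg_left ?_ (by linarith)
    have hη := D.η_pos
    have hk1 : (1 : ℝ) ≤ k := by exact_mod_cast Nat.one_le_iff_ne_zero.2 h0
    have hkN : (k : ℝ) ≤ D.N := by exact_mod_cast hk
    have hjN : (j : ℝ) ≤ D.N := by exact_mod_cast hj
    have hj0 : (0 : ℝ) ≤ j := by positivity
    have hπ := D.N_mul_η
    rw [← cos_abs (_ - _)]
    apply cos_le_cos_of_nonneg_of_le_pi (by linarith)
    · rw [abs_le]; constructor <;> nlinarith
    · rcases lt_or_ge j k with h | h
      · have : (j : ℝ) + 1 ≤ k := by exact_mod_cast h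
        exact le_trans (by nlinarith) (le_abs_self _)
      · have : (k : ℝ) ≤ j := by exact_mod_cast h
        exact le_trans (by nlinarith) (neg_le_abs _)
  · simp only [height, vert_add_one, pt_zero, pt_one]; nlinarith

theorem vert_side_pos {k : ℕ} (h0 : k ≠ 0) (hk : k ≤ D.N) : 0 < D.vert k 1 := by
  rw [D.vert_side h0 hk, pt_one]
  have hη := D.η_pos
  have hk1 : (1 : ℝ) ≤ k := by exact_mod_cast Nat.one_le_iff_ne_zero.2 h0
  have hkN : (k : ℝ) ≤ D.N := by exact_mod_cast hk
  have hπ := D.N_mul_η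
  have := D.cos_half_pos
  have := D.R_gt
  have : 0 < sin (k * D.η - D.η / 2) := sin_pos_of_pos_of_lt_pi (by nlinarith) (by nlinarith)
  positivity

theorem h_le_vert {k : ℕ} (hk : k ≤ D.N + 1) : D.h ≤ D.vert k 1 := by
  rcases eq_or_ne k 0 with rfl | h0
  · simp
  rcases Nat.le_succ_iff.1 hk with hk | rfl
  · linarith [D.vert_side_pos h0 hk, D.h_neg]
  · simp

theorem side_spec {k : ℕ} (hk : k ≤ D.N) {p : Plane}
    (hp : p ∈ segment ℝ (D.vert k) (D.vert (k + 1))) :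
    D.height k p = D.R ∧ p ∈ D.dome ∧ D.h ≤ p 1 := by
  obtain ⟨t, h0, h1, hx, hy⟩ := mem_segment_iff.1 hp
  have key : ∀ j, D.height j p =
      (1 - t) * D.height j (D.vert k) + t * D.height j (D.vert (k + 1)) := by
    intro j; simp only [height, hx, hy]; ring
  refine ⟨?_, fun j hj => ?_, ?_⟩
  · rw [key, D.height_self_vert hk, D.height_vert_succ hk]; ring
  · rw [key]
    have a1 := D.vert_mem_dome (k := k) (by omega) j hj
    have a2 := D.vert_mem_dome (k := k + 1) (by omega) j hj
    nlinarith
  · have a1 := D.h_le_vert (k := k) (by omega)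
    have a2 := D.h_le_vert (k := k + 1) (by omega)
    rw [hy]; nlinarith

theorem one_sub_cos_η : 1 - cos D.η = sin D.η * tan (D.η / 2) := by
  have h := D.cos_half_pos.ne'
  have e1 : cos D.η = 2 * cos (D.η / 2) ^ 2 - 1 := by rw [← cos_two_mul]; ring_nf
  have e2 : sin D.η = 2 * sin (D.η / 2) * cos (D.η / 2) := by rw [← sin_two_mul]; ring_nf
  rw [e1, e2, tan_eq_sin_div_cos]
  field_simp
  linear_combination (-2) * sin_sq_add_cos_sq (D.η / 2)

theorem sin_η_pos : 0 < sin D.η := by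
  have := D.η_pos; have := D.η_le; have := pi_pos
  exact sin_pos_of_pos_of_lt_pi (by linarith) (by linarith)

/-- The constraints of the neighbouring sides bound the coordinate along side `k` by `± R tan (η /
2)`, which is where the vertices are. The two vertical extreme sides have only one neighbour and are
cut off below by the bottom `h`. -/
theorem mem_side {k : ℕ} (hk : k ≤ D.N) {p : Plane} (h1 : D.height k p = D.R)
    (h2 : p ∈ D.dome) (h3 : D.h ≤ p 1) : p ∈ segment ℝ (D.vert k) (D.vert (k + 1)) := by
  have hsin := D.sin_η_pos
  have htan := D.one_sub_cos_η
  have hc := D.cos_half_pos.ne'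
  have hw1 : k ≠ 0 → -(D.R * tan (D.η / 2)) ≤ -sin (k * D.η) * p 0 + cos (k * D.η) * p 1 := by
    intro h0
    have h4 := h2 (k - 1) (by omega)
    rw [height] at h1 h4
    rw [Nat.cast_sub (by omega), Nat.cast_one, sub_mul, one_mul, cos_sub, sin_sub] at h4
    have : D.R * cos D.η - sin D.η * (-sin (k * D.η) * p 0 + cos (k * D.η) * p 1) ≤ D.R := by
      rw [← h1] at h4 ⊢; linarith
    have h5 : sin D.η * (-(D.R * tan (D.η / 2))) ≤
        sin D.η * (-sin (k * D.η) * p 0 + cos (k * D.η) * p 1) := by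
      linear_combination this + D.R * htan
    exact le_of_mul_le_mul_left h5 hsin
  have hw2 : k ≠ D.N → -sin (k * D.η) * p 0 + cos (k * D.η) * p 1 ≤ D.R * tan (D.η / 2) := by
    intro h0
    have h4 := h2 (k + 1) (by omega)
    rw [height] at h1 h4
    rw [Nat.cast_succ, add_mul, one_mul, cos_add, sin_add] at h4
    have : D.R * cos D.η + sin D.η * (-sin (k * D.η) * p 0 + cos (k * D.η) * p 1) ≤ D.R := by
      rw [← h1] at h4 ⊢; linarith
    have h5 : sin D.η * (-sin (k * D.η) * p 0 + cos (k * D.η) * p 1) ≤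
        sin D.η * (D.R * tan (D.η / 2)) := by
      linear_combination this + D.R * htan
    exact le_of_mul_le_mul_left h5 hsin
  have hv1 : k ≠ 0 → D.vert k 0 = D.R * cos (k * D.η) - -(D.R * tan (D.η / 2)) * sin (k * D.η) ∧
      D.vert k 1 = D.R * sin (k * D.η) + -(D.R * tan (D.η / 2)) * cos (k * D.η) := by
    intro h0
    rw [D.vert_side h0 hk, pt_zero, pt_one, cos_sub, sin_sub, tan_eq_sin_div_cos]
    constructor <;> (field_simp; ring)
  have hv2 : k ≠ D.N → D.vert (k + 1) 0 = D.R * cos (k * D.η) - D.R * tan (D.η / 2) * sin (k * D.η) ∧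
      D.vert (k + 1) 1 = D.R * sin (k * D.η) + D.R * tan (D.η / 2) * cos (k * D.η) := by
    intro h0
    rw [D.vert_side (by omega) (by omega), pt_zero, pt_one, Nat.cast_succ,
      show (k + 1) * D.η - D.η / 2 = k * D.η + D.η / 2 by ring, cos_add, sin_add,
      tan_eq_sin_div_cos]
    constructor <;> field_simp
  have hN : D.N ≠ 0 := by have := D.hN; omega
  have e := cos_sq_add_sin_sq (k * D.η)
  rcases eq_or_ne k 0 with rfl | h0
  · have g2 := hw2 hN.symm
    obtain ⟨v1, v2⟩ := hv2 hN.symm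
    exact mem_segment_of_coord e h1 (by simpa using h3) g2 (by simp) (by simp) v1 v2
  · have g1 := hw1 h0
    obtain ⟨u1, u2⟩ := hv1 h0
    rcases eq_or_ne k D.N with rfl | hkN
    · exact mem_segment_of_coord (β := -D.h) e h1 g1 (by simp [N_mul_η, h3]) u1 u2
        (by simp [N_mul_η]) (by simp [N_mul_η])
    · obtain ⟨v1, v2⟩ := hv2 hkN
      exact mem_segment_of_coord e h1 g1 (hw2 hkN) u1 u2 v1 v2

/-- The normal of side `i + 1` lies between those of `i` and `j`. With `a` its angle to the latter,
`sin (η + a) < sin η + sin a`, so a point on both lines would violate the constraint `i + 1`. -/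
theorem not_two_sides {i j : ℕ} (hij : i + 2 ≤ j) (hj : j ≤ D.N) {p : Plane}
    (hi : D.height i p = D.R) (hj' : D.height j p = D.R) (hp : p ∈ D.dome) : False := by
  have hm := hp (i + 1) (by omega)
  have hη := D.η_pos
  have hπ := D.N_mul_η
  have hR := D.R_gt
  have hij' : (i : ℝ) + 2 ≤ j := by exact_mod_cast hij
  have hjN : (j : ℝ) ≤ D.N := by exact_mod_cast hj
  have hi0 : (0 : ℝ) ≤ i := by positivity
  obtain ⟨a, ha⟩ : ∃ a, a = (j - i - 1) * D.η := ⟨_, rfl⟩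
  have ea : j * D.η = i * D.η + D.η + a := by rw [ha]; ring
  have hsa : 0 < sin a := by
    apply sin_pos_of_pos_of_lt_pi <;> rw [ha] <;> nlinarith
  have hca : cos a < 1 := by
    rw [← cos_zero]
    apply cos_lt_cos_of_nonneg_of_le_pi le_rfl <;> rw [ha] <;> nlinarith
  have key : sin (D.η + a) * D.height (i + 1) p = sin a * D.height i p + sin D.η * D.height j p := by
    simp only [height, Nat.cast_succ, ea, add_mul, one_mul, cos_add, sin_add]
    linear_combination (sin a * (cos (i * D.η) * p 0 + sin (i * D.η) * p 1)) *
      cos_sq_add_sin_sq D.η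
  have hs : 0 ≤ sin (D.η + a) := by
    apply sin_nonneg_of_nonneg_of_le_pi <;> rw [ha] <;> nlinarith
  rw [hi, hj'] at key
  have h1 : sin (D.η + a) * D.height (i + 1) p ≤ sin (D.η + a) * D.R :=
    mul_le_mul_of_nonneg_left hm hs
  rw [key, sin_add, ← add_mul] at h1
  have h2 := le_of_mul_le_mul_right h1 (by linarith)
  have := D.sin_η_pos
  have := D.cos_η
  nlinarith

theorem eq_vert_of_adjacent {i : ℕ} (hi : i + 1 ≤ D.N) {p : Plane}
    (h1 : D.height i p = D.R) (h2 : D.height (i + 1) p = D.R) : p = D.vert (i + 1) := by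
  have h3 := D.height_vert_succ (k := i) (by omega)
  have h4 := D.height_self_vert hi
  have hs := D.sin_η_pos.ne'
  rw [← h3] at h1
  rw [← h4] at h2
  simp only [height, Nat.cast_succ, add_mul, one_mul, cos_add, sin_add] at h1 h2
  generalize D.vert (i + 1) = q at *
  have e := cos_sq_add_sin_sq (i * D.η)
  have g : -sin (i * D.η) * (p 0 - q 0) + cos (i * D.η) * (p 1 - q 1) = 0 := by
    apply (mul_eq_zero.1 _).resolve_left hs
    linear_combination h2 - cos D.η * h1
  apply plane_ext
  · linear_combination (-(p 0 - q 0)) * e + cos (i * D.η) * h1 - sin (i * D.η) * g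
  · linear_combination (-(p 1 - q 1)) * e + sin (i * D.η) * h1 + cos (i * D.η) * g

/-! ### The seven low edges in coordinates. -/

theorem mem_segment_horizontal {p : Plane} {x x' y : ℝ} (hx : x ≤ x') :
    p ∈ segment ℝ (pt x y) (pt x' y) ↔ p 1 = y ∧ x ≤ p 0 ∧ p 0 ≤ x' := by
  rw [mem_segment_iff]
  simp only [pt_zero, pt_one]
  constructor
  · rintro ⟨t, h0, h1, e0, e1⟩
    refine ⟨by linarith, ?_, ?_⟩ <;> nlinarith
  · rintro ⟨h1, h2, h3⟩
    rcases eq_or_lt_of_le hx with h | h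
    · exact ⟨0, le_rfl, zero_le_one, by linarith, by linarith⟩
    · have : x' - x ≠ 0 := by linarith
      refine ⟨(p 0 - x) / (x' - x), by apply div_nonneg <;> linarith,
        by rw [div_le_one] <;> linarith, by field_simp; ring, by linarith⟩

theorem mem_segment_vertical {p : Plane} {x y y' : ℝ} (hy : y ≤ y') :
    p ∈ segment ℝ (pt x y) (pt x y') ↔ p 0 = x ∧ y ≤ p 1 ∧ p 1 ≤ y' := by
  rw [mem_segment_iff]
  simp only [pt_zero, pt_one]
  constructor
  · rintro ⟨t, h0, h1, e0, e1⟩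
    refine ⟨by linarith, ?_, ?_⟩ <;> nlinarith
  · rintro ⟨h1, h2, h3⟩
    rcases eq_or_lt_of_le hy with h | h
    · exact ⟨0, le_rfl, zero_le_one, by linarith, by linarith⟩
    · have : y' - y ≠ 0 := by linarith
      refine ⟨(p 1 - y) / (y' - y), by apply div_nonneg <;> linarith,
        by rw [div_le_one] <;> linarith, by linarith, by field_simp; ring⟩

theorem mem_edge_add_one {p : Plane} : p ∈ segment ℝ (D.vert (D.N + 1)) (D.vert (D.N + 2)) ↔
    p 1 = D.h ∧ -D.R ≤ p 0 ∧ p 0 ≤ -D.b := by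
  rw [vert_add_one, vert_add_two, mem_segment_horizontal (by linarith [D.b_lt])]

theorem mem_edge_add_seven {p : Plane} : p ∈ segment ℝ (D.vert (D.N + 7)) (D.vert (D.N + 8)) ↔
    p 1 = D.h ∧ D.b ≤ p 0 ∧ p 0 ≤ D.R := by
  rw [vert_add_seven, vert_add_eight, mem_segment_horizontal (by linarith [D.b_lt])]

theorem mem_edge_add_four {p : Plane} : p ∈ segment ℝ (D.vert (D.N + 4)) (D.vert (D.N + 5)) ↔
    p 1 = -D.L ∧ -1 ≤ p 0 ∧ p 0 ≤ 1 := by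
  rw [vert_add_four, vert_add_five, mem_segment_horizontal (by norm_num)]

theorem mem_edge_add_three {p : Plane} : p ∈ segment ℝ (D.vert (D.N + 3)) (D.vert (D.N + 4)) ↔
    p 0 = -1 ∧ -D.L ≤ p 1 ∧ p 1 ≤ 0 := by
  rw [vert_add_three, vert_add_four, segment_symm, mem_segment_vertical (by linarith [D.hL])]

theorem mem_edge_add_five {p : Plane} : p ∈ segment ℝ (D.vert (D.N + 5)) (D.vert (D.N + 6)) ↔
    p 0 = 1 ∧ -D.L ≤ p 1 ∧ p 1 ≤ 0 := by
  rw [vert_add_five, vert_add_six, mem_segment_vertical (by linarith [D.hL])]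

theorem mem_edge_add_six {p : Plane} : p ∈ segment ℝ (D.vert (D.N + 6)) (D.vert (D.N + 7)) ↔
    D.c * (p 0 - 1) + D.s * p 1 = 0 ∧ D.h ≤ p 1 ∧ p 1 ≤ 0 := by
  rw [vert_add_six, vert_add_seven, mem_segment_iff]
  simp only [pt_zero, pt_one]
  have hb := D.b_rel
  have hh := D.h_neg
  have hc := D.c_pos.ne'
  constructor
  · rintro ⟨t, h0, h1, e0, e1⟩
    refine ⟨by rw [e0, e1]; linear_combination t * hb, ?_, ?_⟩ <;> nlinarith
  · rintro ⟨h1, h2, h3⟩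
    have e : p 1 = p 1 / D.h * D.h := (div_mul_cancel₀ _ hh.ne).symm
    refine ⟨p 1 / D.h, div_nonneg_of_nonpos h3 hh.le, (div_le_one_of_neg hh).2 h2, ?_, by linarith⟩
    apply mul_left_cancel₀ hc
    linear_combination h1 - D.s * e - (p 1 / D.h) * hb

theorem mem_edge_add_two {p : Plane} : p ∈ segment ℝ (D.vert (D.N + 2)) (D.vert (D.N + 3)) ↔
    D.c * (-p 0 - 1) + D.s * p 1 = 0 ∧ D.h ≤ p 1 ∧ p 1 ≤ 0 := by
  have h := D.mem_edge_add_six (p := pt (-p 0) (p 1))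
  rw [vert_add_six, vert_add_seven, mem_segment_iff] at h
  rw [vert_add_two, vert_add_three, segment_symm, mem_segment_iff]
  simp only [pt_zero, pt_one] at h ⊢
  rw [← h]
  refine exists_congr fun t => and_congr_right fun _ => and_congr_right fun _ =>
    and_congr_left fun _ => ?_
  constructor <;> intro h <;> linarith

/-- The slanted edges as monotone curves over their range of abscissas. -/
theorem slanted_edge_abscissa {x y : ℝ}
    (h : D.c * (x - 1) + D.s * y = 0 ∧ D.h ≤ y ∧ y ≤ 0) :
    1 ≤ x ∧ x ≤ D.b ∧ (x = 1 → y = 0) ∧ (x = D.b → y = D.h) := by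
  obtain ⟨h1, h2, h3⟩ := h
  have hc := D.c_pos
  have hs := D.s_pos
  have hb := D.b_rel
  refine ⟨?_, ?_, fun e => ?_, fun e => ?_⟩
  · by_contra hlt
    nlinarith
  · by_contra hlt
    nlinarith
  · rw [e] at h1
    have : D.s * y = 0 := by linarith
    exact (mul_eq_zero.1 this).resolve_left hs.ne'
  · rw [e] at h1
    exact mul_left_cancel₀ hs.ne' (by linarith)

/-- The sine of a side's angle is nonnegative, so below the axis the height is at most `|p 0|`. -/
theorem side_ne_low {k : ℕ} (hk : k ≤ D.N) {p : Plane} (h1 : D.height k p = D.R)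
    (hy : p 1 ≤ 0) (hx : |p 0| < D.R) : False := by
  rw [abs_lt] at hx
  have hs := D.sin_nonneg_side hk
  have c1 := cos_le_one (k * D.η)
  have c2 := neg_one_le_cos (k * D.η)
  rw [height] at h1
  rcases le_total 0 (p 0) with h | h <;> nlinarith

theorem eq_zero_of_height {k : ℕ} (hk : k ≤ D.N) {p : Plane} (h1 : D.height k p = D.R)
    (hy : p 1 < 0) (hx : p 0 = D.R) : k = 0 := by
  by_contra h0
  have hR := D.R_gt
  have hs := D.sin_nonneg_side hk
  have c1 := cos_le_one (k * D.η)
  rw [height, hx] at h1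
  rcases eq_or_lt_of_le hk with rfl | hlt
  · rw [N_mul_η, cos_pi, sin_pi] at h1
    linarith
  · have := D.sin_pos_side (by omega) hlt
    nlinarith

theorem eq_N_of_height {k : ℕ} (hk : k ≤ D.N) {p : Plane} (h1 : D.height k p = D.R)
    (hy : p 1 < 0) (hx : p 0 = -D.R) : k = D.N := by
  by_contra h0
  have hR := D.R_gt
  have c1 := neg_one_le_cos (k * D.η)
  rw [height, hx] at h1
  rcases Nat.eq_zero_or_pos k with rfl | hpos
  · simp at h1
    linarith
  · have := D.sin_pos_side hpos (by omega)
    nlinarith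

/-! ### Simplicity of the polygon. -/

theorem edges_inter_of_lt {i j : ℕ} (hij : i < j) (hj : j < D.N + 8) {p : Plane}
    (hi : p ∈ segment ℝ (D.vert i) (D.vert (i + 1)))
    (hj' : p ∈ segment ℝ (D.vert j) (D.vert (j + 1))) :
    (p = D.vert i ∨ p = D.vert (i + 1)) ∧ (p = D.vert j ∨ p = D.vert (j + 1)) := by
  have hb := D.b_gt
  have hb' := D.b_lt
  have hh := D.h_neg
  have hL := D.neg_L_lt
  rcases le_or_gt i D.N with hiN | hiN
  · obtain ⟨h1, h2, -⟩ := D.side_spec hiN hi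
    rcases le_or_gt j D.N with hjN | hjN
    · obtain ⟨h1', -, -⟩ := D.side_spec hjN hj'
      rcases Nat.lt_or_ge j (i + 2) with h | h
      · obtain rfl : j = i + 1 := by omega
        have := D.eq_vert_of_adjacent hjN h1 h1'
        exact ⟨Or.inr this, Or.inl this⟩
      · exact (D.not_two_sides h hjN h1 h1' h2).elim
    · have hx := D.abs_le_of_mem_dome h2
      have low := D.side_ne_low hiN h1
      obtain ⟨m, rfl⟩ : ∃ m, j = D.N + m := ⟨j - D.N, by omega⟩
      have : 1 ≤ m := by omega
      have : m ≤ 7 := by omega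
      interval_cases m
      · rw [add_assoc, mem_edge_add_one] at hj'
        rcases eq_or_lt_of_le hx with hx | hx
        · have hx0 : p 0 = -D.R := by
            rw [abs_of_nonpos (by linarith)] at hx; linarith
          obtain rfl := D.eq_N_of_height hiN h1 (by linarith) hx0
          have : p = D.vert (D.N + 1) := by
            apply plane_ext <;> simp [hx0, hj'.1]
          exact ⟨Or.inr this, Or.inl this⟩
        · exact (low (by linarith) hx).elim
      · rw [add_assoc, mem_edge_add_two] at hj'
        have := D.slanted_edge_abscissa hj'
        exact (low (by linarith) (by rw [abs_lt]; constructor <;> linarith)).elim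
      · rw [add_assoc, mem_edge_add_three] at hj'
        exact (low (by linarith) (by rw [abs_lt]; constructor <;> linarith)).elim
      · rw [add_assoc, mem_edge_add_four] at hj'
        exact (low (by linarith) (by rw [abs_lt]; constructor <;> linarith)).elim
      · rw [add_assoc, mem_edge_add_five] at hj'
        exact (low (by linarith) (by rw [abs_lt]; constructor <;> linarith)).elim
      · rw [add_assoc, mem_edge_add_six] at hj'
        have := D.slanted_edge_abscissa hj'
        exact (low (by linarith) (by rw [abs_lt]; constructor <;> linarith)).elim
      · rw [add_assoc, mem_edge_add_seven] at hj'
        rcases eq_or_lt_of_le hx with hx | hx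
        · have hx0 : p 0 = D.R := by
            rw [abs_of_nonneg (by linarith)] at hx; linarith
          obtain rfl := D.eq_zero_of_height hiN h1 (by linarith) hx0
          have : p = D.vert 0 := by
            apply plane_ext <;> simp [hx0, hj'.1]
          exact ⟨Or.inl this, Or.inr (by rw [this]; simp)⟩
        · exact (low (by linarith) hx).elim
  · obtain ⟨l, rfl⟩ : ∃ l, i = D.N + l := ⟨i - D.N, by omega⟩
    obtain ⟨m, rfl⟩ : ∃ m, j = D.N + m := ⟨j - D.N, by omega⟩
    have : 1 ≤ l := by omega
    have : m ≤ 7 := by omega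
    have : l < m := by omega
    have adj : ∀ {n : ℕ} {x y : ℝ} {q r : Plane}, D.vert n = pt x y → p 0 = x → p 1 = y →
        (p = q ∨ p = D.vert n) ∧ (p = D.vert n ∨ p = r) := by
      intro n x y q r e hx hy
      have : p = D.vert n := by
        rw [e]
        apply plane_ext <;> simpa
      exact ⟨Or.inr this, Or.inl this⟩
    obtain ⟨x, hx⟩ : ∃ x : ℝ, p 0 = x := ⟨_, rfl⟩
    obtain ⟨y, hy⟩ : ∃ y : ℝ, p 1 = y := ⟨_, rfl⟩
    simp only [hx, hy] at adj
    have sl := @slanted_edge_abscissa D x y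
    have sl' := @slanted_edge_abscissa D (-x) y
    -- Once the slanted edges are replaced by their ranges of abscissas, linear arithmetic settles
    -- each of the 21 pairs: it is either contradictory or forces the shared vertex.
    interval_cases m <;> interval_cases l <;>
      simp only [add_assoc, Nat.reduceAdd, mem_edge_add_one, mem_edge_add_two, mem_edge_add_three,
        mem_edge_add_four, mem_edge_add_five, mem_edge_add_six, mem_edge_add_seven, hx, hy] at hi hj' ⊢ <;>
      (try replace hi := sl hi) <;> (try replace hi := sl' hi) <;>
      (try replace hj' := sl hj') <;> (try replace hj' := sl' hj') <;> clear sl sl' hx hy <;>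
      obtain ⟨a1, a2, a3⟩ := hi <;> obtain ⟨b1, b2, b3⟩ := hj' <;>
      first
        | (exfalso; linarith)
        | (have := a3.1 (by linarith); exfalso; linarith)
        | (have := b3.1 (by linarith); exfalso; linarith)
        | exact adj D.vert_add_two (by linarith) (by linarith)
        | exact adj D.vert_add_three (by linarith) (by linarith)
        | exact adj D.vert_add_four (by linarith) (by linarith)
        | exact adj D.vert_add_five (by linarith) (by linarith)
        | exact adj D.vert_add_six (by linarith) (by linarith)
        | exact adj D.vert_add_seven (by linarith) (by linarith)
        | (have := a3.1 (by linarith); exact adj D.vert_add_three (by linarith) (by linarith))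
        | (have := b3.1 (by linarith); exact adj D.vert_add_six (by linarith) (by linarith))

theorem vert_low_nonpos {k : ℕ} (h0 : D.N < k) : D.vert k 1 ≤ 0 := by
  have hh := D.h_neg
  have hL := D.hL
  rw [vert, if_neg (by omega), if_neg (by omega)]
  split <;> simp only [pt_one] <;> linarith

theorem vert_ne_of_lt {i j : ℕ} (hij : i < j) (hj : j < D.N + 8) : D.vert i ≠ D.vert j := by
  intro e
  have hb := D.b_gt
  have hb' := D.b_lt
  have hL := D.hL
  have hh := D.h_neg
  rcases Nat.eq_zero_or_pos i with rfl | hi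
  · rcases le_or_gt j D.N with hjN | hjN
    · have := D.vert_side_pos (by omega) hjN
      rw [← e, vert_zero, pt_one] at this
      linarith
    · obtain ⟨m, rfl⟩ : ∃ m, j = D.N + m := ⟨j - D.N, by omega⟩
      have : 1 ≤ m := by omega
      have : m ≤ 7 := by omega
      have e0 := congrArg (· 0) e
      interval_cases m <;> simp at e0 <;> linarith
  · rcases le_or_gt i D.N with hiN | hiN
    · rcases le_or_gt j D.N with hjN | hjN
      -- Vertex `i` lies on side `i - 1`, and vertex `j` on side `j`.
      · refine D.not_two_sides (i := i - 1) (j := j) (by omega) hjN (p := D.vert i) ?_ ?_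
          (D.vert_mem_dome (by omega))
        · have := D.height_vert_succ (k := i - 1) (by omega)
          rwa [Nat.sub_add_cancel hi] at this
        · rw [e, D.height_self_vert hjN]
      · have := D.vert_side_pos (by omega) hiN
        have := D.vert_low_nonpos hjN
        rw [← e] at this
        linarith
    · obtain ⟨l, rfl⟩ : ∃ l, i = D.N + l := ⟨i - D.N, by omega⟩
      obtain ⟨m, rfl⟩ : ∃ m, j = D.N + m := ⟨j - D.N, by omega⟩
      have : 1 ≤ l := by omega
      have : m ≤ 7 := by omega
      have : l < m := by omega
      have e0 := congrArg (· 0) e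
      have e1 := congrArg (· 1) e
      interval_cases m <;> interval_cases l <;> simp at e0 e1 <;> linarith

theorem isSimplePolygon_outline : IsSimplePolygon D.outline where
  three_le := by omega
  injective := by
    intro i j h
    by_contra hne
    rcases lt_or_gt_of_ne (fun h => hne (Fin.ext h) : (i : ℕ) ≠ j) with hlt | hlt
    · exact D.vert_ne_of_lt hlt j.2 h
    · exact D.vert_ne_of_lt hlt i.2 h.symm
  edges_inter := by
    intro i j hne p hp
    rw [outline_next, outline_next, outline_vertices, outline_vertices]
    rw [outline_edgeSet, outline_edgeSet] at hp
    rcases lt_or_gt_of_ne (fun h => hne (Fin.ext h) : (i : ℕ) ≠ j) with hlt | hlt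
    · exact D.edges_inter_of_lt hlt j.2 hp.1 hp.2
    · exact (D.edges_inter_of_lt hlt i.2 hp.2 hp.1).symm

/-! ### The polygon bounds the region. -/

theorem mem_boundary_iff {p : Plane} : p ∈ D.outline.boundary ℝ ↔
    ∃ k < D.N + 8, p ∈ segment ℝ (D.vert k) (D.vert (k + 1)) := by
  simp only [Polygon.boundary, Set.mem_iUnion, outline_edgeSet]
  exact ⟨fun ⟨i, h⟩ => ⟨i, i.2, h⟩, fun ⟨k, hk, h⟩ => ⟨⟨k, hk⟩, h⟩⟩

theorem mem_dome_of_low {p : Plane} (hx : |p 0| ≤ D.R) (hy : p 1 ≤ 0) : p ∈ D.dome := by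
  intro k hk
  rw [abs_le] at hx
  have hs := D.sin_nonneg_side hk
  have c1 := cos_le_one (k * D.η)
  have c2 := neg_one_le_cos (k * D.η)
  rw [height]
  rcases le_total 0 (p 0) with h | h <;> nlinarith

theorem boundary_subset_region : D.outline.boundary ℝ ⊆ D.region := by
  intro p hp
  obtain ⟨k, hk, hp⟩ := D.mem_boundary_iff.1 hp
  have hb := D.b_gt
  have hb' := D.b_lt
  have hh := D.h_neg
  have hL := D.neg_L_lt
  have hc := D.c_pos
  have hs := D.s_pos
  have hrel := D.b_rel
  have basin_of : D.h ≤ p 1 → D.b ≤ |p 0| → p ∈ D.basin := fun h1 h2 => ⟨h1, by nlinarith⟩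
  rcases le_or_gt k D.N with hkN | hkN
  · obtain ⟨h1, h2, h3⟩ := D.side_spec hkN hp
    refine ⟨h2, ?_⟩
    rcases le_or_gt (|p 0|) 1 with hx | hx
    · exact Or.inl ⟨hx, by linarith⟩
    · refine Or.inr ?_
      rcases le_total 0 (p 1) with hy | hy
      · exact ⟨h3, add_nonneg (mul_nonneg hc.le (by linarith)) (mul_nonneg hs.le hy)⟩
      · refine basin_of h3 ?_
        by_contra hlt
        exact D.side_ne_low hkN h1 hy (by linarith)
  · obtain ⟨m, rfl⟩ : ∃ m, k = D.N + m := ⟨k - D.N, by omega⟩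
    have : 1 ≤ m := by omega
    have : m ≤ 7 := by omega
    interval_cases m
    · rw [add_assoc, mem_edge_add_one] at hp
      have hx : |p 0| = -p 0 := abs_of_nonpos (by linarith)
      exact ⟨D.mem_dome_of_low (by linarith) (by linarith),
        Or.inr (basin_of (by linarith) (by linarith))⟩
    · rw [add_assoc, mem_edge_add_two] at hp
      have := D.slanted_edge_abscissa hp
      have hx : |p 0| = -p 0 := abs_of_nonpos (by linarith)
      exact ⟨D.mem_dome_of_low (by linarith) (by linarith),
        Or.inr ⟨hp.2.1, by rw [hx]; exact hp.1.ge⟩⟩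
    · rw [add_assoc, mem_edge_add_three] at hp
      have hx : |p 0| = 1 := by rw [hp.1]; simp
      exact ⟨D.mem_dome_of_low (by linarith) (by linarith), Or.inl ⟨hx.le, hp.2.1⟩⟩
    · rw [add_assoc, mem_edge_add_four] at hp
      have hx : |p 0| ≤ 1 := abs_le.2 hp.2
      exact ⟨D.mem_dome_of_low (by linarith) (by linarith), Or.inl ⟨hx, hp.1.ge⟩⟩
    · rw [add_assoc, mem_edge_add_five] at hp
      have hx : |p 0| = 1 := by rw [hp.1]; simp
      exact ⟨D.mem_dome_of_low (by linarith) (by linarith), Or.inl ⟨hx.le, hp.2.1⟩⟩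
    · rw [add_assoc, mem_edge_add_six] at hp
      have := D.slanted_edge_abscissa hp
      have hx : |p 0| = p 0 := abs_of_nonneg (by linarith)
      exact ⟨D.mem_dome_of_low (by linarith) (by linarith),
        Or.inr ⟨hp.2.1, by rw [hx]; exact hp.1.ge⟩⟩
    · rw [add_assoc, mem_edge_add_seven] at hp
      have hx : |p 0| = p 0 := abs_of_nonneg (by linarith)
      exact ⟨D.mem_dome_of_low (by linarith) (by linarith),
        Or.inr (basin_of (by linarith) (by linarith))⟩

theorem mem_openRegion_or_boundary {p : Plane} (hp : p ∈ D.region) :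
    p ∈ D.openRegion ∨ p ∈ D.outline.boundary ℝ := by
  rw [or_iff_not_imp_right, mem_boundary_iff]
  intro hn
  have edge : ∀ m ≤ 7, p ∉ segment ℝ (D.vert (D.N + m)) (D.vert (D.N + (m + 1))) :=
    fun m hm h => hn ⟨D.N + m, by omega, h⟩
  have hb := D.b_gt
  have hb' := D.b_lt
  have hh := D.h_neg
  have hL := D.neg_L_lt
  have hc := D.c_pos
  have hs := D.s_pos
  have hrel := D.b_rel
  have hR := D.abs_le_of_mem_dome hp.1
  have e1 := edge 1 (by norm_num)
  have e2 := edge 2 (by norm_num)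
  have e3 := edge 3 (by norm_num)
  have e4 := edge 4 (by norm_num)
  have e5 := edge 5 (by norm_num)
  have e6 := edge 6 (by norm_num)
  have e7 := edge 7 (by norm_num)
  norm_num only at e1 e2 e3 e4 e5 e6 e7
  rw [mem_edge_add_one] at e1
  rw [mem_edge_add_two] at e2
  rw [mem_edge_add_three] at e3
  rw [mem_edge_add_four] at e4
  rw [mem_edge_add_five] at e5
  rw [mem_edge_add_six] at e6
  rw [mem_edge_add_seven] at e7
  have hsign : p 0 = |p 0| ∨ p 0 = -|p 0| := by
    rcases abs_choice (p 0) with h | h <;> rw [h] <;> simp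
  refine ⟨fun k hk => lt_of_le_of_ne (hp.1 k hk) fun he => ?_, ?_⟩
  · refine hn ⟨k, by omega, D.mem_side hk he hp.1 ?_⟩
    rcases hp.2 with h | h
    · by_contra hlt
      exact D.side_ne_low hk he (by linarith) (by linarith [h.1])
    · exact h.1
  · generalize hX : |p 0| = X at *
    -- The lines `|x| = 1` are walls only up to the tips; above them the point is strictly inside
    -- the basin.
    have hwall : X = 1 → -D.L ≤ p 1 → ¬ p 1 ≤ 0 := by
      rintro rfl h1 h2
      rcases hsign with h | h
      · exact e5 ⟨h, h1, h2⟩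
      · exact e3 ⟨h, h1, h2⟩
    rcases le_or_gt X 1 with hx | hx
    · have hlow : -D.L ≤ p 1 := by
        rcases hp.2 with h | h <;> linarith [h.1, h.2]
      rcases eq_or_lt_of_le hx with hx1 | hx1
      · have hy := hwall hx1 hlow
        rw [not_le] at hy
        refine Or.inr ⟨by linarith, ?_⟩
        rw [hX, hx1]
        have := mul_pos hs hy
        linarith
      · refine Or.inl ⟨hX.symm ▸ hx1, lt_of_le_of_ne hlow fun he => e4 ⟨he.symm, ?_⟩⟩
        exact abs_le.1 (hX.le.trans hx)
    · rcases hp.2 with h | h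
      · have := h.1
        linarith
      · obtain ⟨h1, h2⟩ := h
        rw [hX] at h2
        refine Or.inr ⟨lt_of_le_of_ne h1 fun he => ?_, lt_of_le_of_ne (hX.symm ▸ h2) fun he => ?_⟩
        · have hbX : D.b ≤ X := by
            rw [← he] at h2
            by_contra hlt
            nlinarith
          rcases hsign with h | h
          · exact e7 ⟨he.symm, by linarith, by linarith⟩
          · exact e1 ⟨he.symm, by linarith, by linarith⟩
        · rw [hX] at he
          have hy : p 1 ≤ 0 := by
            by_contra hlt
            nlinarith
          rcases hsign with h | h
          · exact e6 ⟨by rw [h]; exact he.symm, h1, hy⟩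
          · exact e2 ⟨by rw [h, neg_neg]; exact he.symm, h1, hy⟩

/-- No Jordan curve theorem is needed. Outside points reach infinity along a ray missing the
boundary. Off the boundary the plane is covered by the disjoint open sets `openRegion` and the
complement of the region, so components starting inside stay in the bounded region. -/
theorem workspace_outline : workspace D.outline = D.region := by
  ext p
  constructor
  · rintro (hp | ⟨hp, hbdd⟩)
    · exact D.boundary_subset_region hp
    · by_contra hpr
      obtain ⟨d, hd, hray⟩ := D.exists_ray hpr
      have hsub : (fun t : ℝ => p + t • d) '' Set.Ici 0 ⊆
          connectedComponentIn (D.outline.boundary ℝ)ᶜ p := by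
        refine IsPreconnected.subset_connectedComponentIn ?_ ⟨0, Set.self_mem_Ici, by simp⟩ ?_
        · exact isPreconnected_Ici.image _ (by fun_prop)
        · rintro _ ⟨t, ht, rfl⟩ hq
          exact hray t ht (D.boundary_subset_region hq)
      obtain ⟨r, hr⟩ := (Metric.isBounded_iff_subset_closedBall p).1 (hbdd.subset hsub)
      have hd' : 0 < ‖d‖ := norm_pos_iff.2 hd
      have hmem := hr ⟨(|r| + 1) / ‖d‖, Set.mem_Ici.2 (by positivity), rfl⟩
      rw [Metric.mem_closedBall, dist_eq_norm, add_sub_cancel_left, norm_smul, Real.norm_eq_abs,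
        abs_of_pos (by positivity), div_mul_cancel₀ _ hd'.ne'] at hmem
      linarith [le_abs_self r]
  · intro hp
    by_cases hb : p ∈ D.outline.boundary ℝ
    · exact Or.inl hb
    · refine Or.inr ⟨hb, D.isBounded_region.subset ?_⟩
      refine Set.Subset.trans ?_ D.openRegion_subset
      refine isPreconnected_connectedComponentIn.subset_left_of_subset_union D.isOpen_openRegion
        D.isClosed_region.isOpen_compl ?_ ?_ ⟨p, mem_connectedComponentIn hb, ?_⟩
      · exact Set.disjoint_compl_right_iff_subset.2 D.openRegion_subset
      · intro q hq
        have hqb := connectedComponentIn_subset _ _ hq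
        by_cases hqr : q ∈ D.region
        · exact Or.inl ((D.mem_openRegion_or_boundary hqr).resolve_right hqb)
        · exact Or.inr hqr
      · exact (D.mem_openRegion_or_boundary hp).resolve_right hb

end Flask

/-! ### Constraints on free positions, and unsolvability. -/

/-- Reflection in the vertical axis. -/
noncomputable def mirror (p : Plane) : Plane := pt (-p 0) (p 1)

@[simp] theorem mirror_zero (p : Plane) : mirror p 0 = -p 0 := pt_zero _ _

@[simp] theorem mirror_one (p : Plane) : mirror p 1 = p 1 := pt_one _ _

@[simp] theorem mirror_mirror (p : Plane) : mirror (mirror p) = p := by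
  apply plane_ext <;> simp

theorem continuous_mirror : Continuous mirror := continuous_pt (by fun_prop) (by fun_prop)

theorem dist_mirror (p q : Plane) : dist (mirror p) q = dist p (mirror q) := by
  rw [dist_eq_sqrt, dist_eq_sqrt]
  simp only [mirror_zero, mirror_one]
  ring_nf

namespace Flask

variable (D : Flask)

/-- The free space of the region. -/
def free : Set Plane := {p | Metric.ball p 1 ⊆ D.region}

theorem freeSpace_outline : freeSpace (workspace D.outline) = D.free := by
  ext p
  rw [workspace_outline]
  simp only [freeSpace, obstacleSpace, free, Set.mem_ofPred_eq]
  rw [← Set.disjoint_iff_inter_eq_empty, Set.disjoint_compl_right_iff_subset]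

theorem mirror_mem_region {p : Plane} (hp : p ∈ D.region) : mirror p ∈ D.region := by
  refine ⟨fun k hk => ?_, ?_⟩
  · have h := hp.1 (D.N - k) (Nat.sub_le _ _)
    rw [height, Nat.cast_sub hk, sub_mul, D.N_mul_η, cos_pi_sub, sin_pi_sub] at h
    rw [height, mirror_zero, mirror_one]
    linarith
  · refine hp.2.imp (fun h => ?_) (fun h => ?_)
    · exact ⟨by simpa using h.1, by simpa using h.2⟩
    · exact ⟨by simpa using h.1, by simpa using h.2⟩

theorem mirror_mem_free {p : Plane} (hp : p ∈ D.free) : mirror p ∈ D.free := by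
  intro q hq
  rw [← mirror_mirror q]
  apply D.mirror_mem_region
  apply hp
  rwa [Metric.mem_ball, dist_mirror]

theorem mem_region_of_dist_le {p q : Plane} (hp : p ∈ D.free) (h : dist q p ≤ 1) :
    q ∈ D.region := by
  have := closure_minimal hp D.isClosed_region
  rw [closure_ball p one_ne_zero] at this
  exact this h

theorem height_le_of_mem_free {p : Plane} (hp : p ∈ D.free) {k : ℕ} (hk : k ≤ D.N) :
    D.height k p ≤ 2 * cos D.η := by
  have e := cos_sq_add_sin_sq (k * D.η)
  have h := (D.mem_region_of_dist_le (q := pt (p 0 + cos (k * D.η)) (p 1 + sin (k * D.η))) hp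
    (by rw [dist_eq_sqrt]; simp [e])).1 k hk
  rw [height, pt_zero, pt_one, R] at h
  rw [height]
  linarith

/-- Here `q` is a limit of points outside the region, so no open unit disc inside the region
contains it. -/
theorem one_le_dist_of_ray {p q d : Plane} (hp : p ∈ D.free)
    (hd : ∀ ε : ℝ, 0 < ε → q + ε • d ∉ D.region) : 1 ≤ dist q p := by
  by_contra! hlt
  have hpos : 0 < ‖d‖ + 1 := by positivity
  have hε : 0 < (1 - dist q p) / (‖d‖ + 1) := div_pos (by linarith) hpos
  refine hd _ hε (hp ?_)
  have h1 : dist (q + ((1 - dist q p) / (‖d‖ + 1)) • d) q =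
      (1 - dist q p) / (‖d‖ + 1) * ‖d‖ := by
    rw [dist_eq_norm, add_sub_cancel_left, norm_smul, Real.norm_of_nonneg hε.le]
  have h2 : (1 - dist q p) / (‖d‖ + 1) * (‖d‖ + 1) = 1 - dist q p := div_mul_cancel₀ _ hpos.ne'
  have h3 := dist_triangle (q + ((1 - dist q p) / (‖d‖ + 1)) • d) q p
  rw [Metric.mem_ball]
  linarith

/-- The free space keeps distance one from the obstacles beside the corridor. -/
theorem one_le_dist_of_right {p q : Plane} (hp : p ∈ D.free) (hx : 1 ≤ q 0)
    (hq : D.c * (q 0 - 1) + D.s * q 1 ≤ 0 ∨ q 1 ≤ D.h) : 1 ≤ dist q p := by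
  have hc := D.c_pos
  have hs := D.s_pos
  -- This direction leaves the corridor to the right and decreases both the ordinate and `c x + s
  -- y`.
  refine D.one_le_dist_of_ray (d := pt D.s (-2 * D.c)) hp fun ε hε h => ?_
  have hεs := mul_pos hε hs
  have hεc := mul_pos hε hc
  have hcs := mul_pos hεc hs
  have hx' : (q + ε • pt D.s (-2 * D.c)) 0 = q 0 + ε * D.s := by simp
  have hy' : (q + ε • pt D.s (-2 * D.c)) 1 = q 1 - 2 * (ε * D.c) := by simp; ring
  have habs : |q 0 + ε * D.s| = q 0 + ε * D.s := abs_of_pos (by linarith)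
  rcases h.2 with ⟨h1, -⟩ | ⟨h1, h2⟩
  · rw [hx', habs] at h1
    linarith
  · rw [hx', hy', habs] at h2
    rw [hy'] at h1
    rcases hq with hq | hq
    · nlinarith
    · linarith

theorem abs_lt_two_of_mem_free {p : Plane} (hp : p ∈ D.free) : |p 0| < 2 := by
  have h1 := D.height_le_of_mem_free hp (Nat.zero_le _)
  have h2 := D.height_le_of_mem_free hp le_rfl
  have := D.cos_η
  simp only [height_zero, height_N] at h1 h2
  exact abs_lt.2 ⟨by linarith, by linarith⟩

/-- The point `(1, p 1)` bounds the obstacle, so `p 0 ≤ 0` or `p 0 ≥ 2`, and the dome excludes the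
latter. The mirror image gives the other inequality. -/
theorem eq_zero_of_mem_free_of_nonpos {p : Plane} (hp : p ∈ D.free) (hy : p 1 ≤ 0) :
    p 0 = 0 := by
  have aux : ∀ q ∈ D.free, q 1 ≤ 0 → q 0 ≤ 0 := by
    intro q hq hy
    have h := D.one_le_dist_of_right (q := pt 1 (q 1)) hq (by simp)
      (Or.inl (by simpa using mul_nonpos_of_nonneg_of_nonpos D.s_pos.le hy))
    rw [le_dist_iff one_pos, pt_zero, pt_one] at h
    have h2 := (abs_lt.1 (D.abs_lt_two_of_mem_free hq)).2
    nlinarith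
  have h1 := aux p hp hy
  have h2 := aux _ (D.mirror_mem_free hp) (by simpa using hy)
  rw [mirror_zero] at h2
  linarith

/-- Free positions in the chamber are close to the exit of the corridor. -/
theorem sq_add_sq_lt_of_mem_free {p : Plane} (hp : p ∈ D.free) (hy : 0 ≤ p 1) :
    p 0 ^ 2 + p 1 ^ 2 < 4 := by
  obtain ⟨k, hk, h⟩ := D.exists_height_ge hy
  have h1 := h.trans (D.height_le_of_mem_free hp hk)
  have hlt : cos D.η < cos (D.η / 2) := by
    have := D.η_pos; have := D.η_le; have := pi_pos
    exact cos_lt_cos_of_nonneg_of_le_pi (by linarith) (by linarith) (by linarith)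
  have hpos := D.cos_half_pos
  have h2 : √(p 0 ^ 2 + p 1 ^ 2) < 2 := by
    by_contra! hge
    nlinarith
  rw [Real.sqrt_lt' (by norm_num)] at h2
  linarith

theorem not_solvable {S T : Finset Plane} (hS : 1 < S.card) (hS0 : ∀ p ∈ S, 0 < p 1)
    (hT0 : ∀ p ∈ T, p 1 < 0) : ¬ Solvable D.free S T := by
  rintro ⟨path, hpath⟩
  obtain ⟨a, ha, b, hb, hab⟩ := Finset.one_lt_card.1 hS
  have key : ∀ s s' : S, s ≠ s' → ∀ τ, path s τ 1 = 0 → 0 ≤ path s' τ 1 → False := by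
    intro s s' hne τ h1 h2
    refine hpath.no_collision s s' hne τ ?_
    have hx := D.eq_zero_of_mem_free_of_nonpos (hpath.mem_free s τ) h1.le
    have := D.sq_add_sq_lt_of_mem_free (hpath.mem_free s' τ) h2
    rw [Metric.mem_ball, dist_lt_iff two_pos, hx, h1]
    linarith
  let f : unitInterval → ℝ := fun τ => path ⟨a, ha⟩ τ 1
  let g : unitInterval → ℝ := fun τ => path ⟨b, hb⟩ τ 1
  have hf : Continuous f := by have := hpath.continuous ⟨a, ha⟩; fun_prop
  have hg : Continuous g := by have := hpath.continuous ⟨b, hb⟩; fun_prop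
  have hf0 : 0 < f 0 := by simpa only [f, hpath.start] using hS0 a ha
  have hg0 : 0 < g 0 := by simpa only [g, hpath.start] using hS0 b hb
  have hf1 : f 1 < 0 := by
    have : path ⟨a, ha⟩ 1 ∈ (T : Set Plane) := by rw [← hpath.target]; exact ⟨_, rfl⟩
    exact hT0 _ this
  -- At a zero of the minimum one robot has height 0 and the other is not below it.
  have hmin : Continuous fun τ => min (f τ) (g τ) := hf.min hg
  obtain ⟨τ, -, hτ⟩ := isPreconnected_univ.intermediate_value (Set.mem_univ (1 : unitInterval))
    (Set.mem_univ 0) hmin.continuousOn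
    (show (0 : ℝ) ∈ Set.Icc _ _ from ⟨(min_le_left _ _).trans hf1.le, le_min hf0.le hg0.le⟩)
  have hne : (⟨a, ha⟩ : S) ≠ ⟨b, hb⟩ := fun h => hab (congrArg Subtype.val h)
  rcases min_choice (f τ) (g τ) with h | h
  · have h1 : f τ = 0 := h ▸ hτ
    exact key _ _ hne τ h1 (by rw [← hτ]; exact min_le_right (f τ) (g τ))
  · have h1 : g τ = 0 := h ▸ hτ
    exact key _ _ hne.symm τ h1 (by rw [← hτ]; exact min_le_left (f τ) (g τ))

/-! ### Sufficient conditions for free positions, and connectedness. -/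

theorem unit_combination_le {γ σ x y : ℝ} (hu : γ ^ 2 + σ ^ 2 = 1) {r : ℝ} (hr : 0 ≤ r)
    (h : x ^ 2 + y ^ 2 ≤ r ^ 2) : γ * x + σ * y ≤ r := by
  apply le_of_sq_le_sq _ hr
  nlinarith [sq_nonneg (γ * y - σ * x)]

theorem ball_subset_dome {p : Plane} (hp : ∀ k ≤ D.N, D.height k p ≤ 2 * cos D.η) {q : Plane}
    (hq : q ∈ Metric.ball p 1) : q ∈ D.dome := by
  intro k hk
  rw [Metric.mem_ball, dist_lt_iff one_pos] at hq
  have h1 := hp k hk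
  have h2 := unit_combination_le (cos_sq_add_sin_sq (k * D.η)) zero_le_one hq.le
  rw [height] at h1 ⊢
  rw [R]
  linarith

theorem height_le_of_sq_le {p : Plane} (hp : p 0 ^ 2 + p 1 ^ 2 ≤ (2 * cos D.η) ^ 2) (k : ℕ) :
    D.height k p ≤ 2 * cos D.η :=
  unit_combination_le (cos_sq_add_sin_sq _) (by linarith [D.cos_η]) hp

theorem mem_free_corridor {p : Plane} (hx : p 0 = 0) (hy : p 1 ≤ 0) (hL : 1 - D.L ≤ p 1) :
    p ∈ D.free := by
  intro q hq
  have hdome := D.ball_subset_dome (p := p) (fun k hk => ?_) hq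
  · rw [Metric.mem_ball, dist_lt_iff one_pos, hx] at hq
    refine ⟨hdome, Or.inl ⟨abs_le_of_sq_le_sq (by nlinarith) zero_le_one, ?_⟩⟩
    nlinarith
  · have := D.sin_nonneg_side hk
    have := D.cos_η
    rw [height, hx]
    nlinarith

/-- All conditions here are linear in `p`, hence inherited by segments: distance 1 from the dome
sides, the bottom and the right slanted line. -/
theorem mem_free_cap {p : Plane} (hp : ∀ k ≤ D.N, D.height k p ≤ 2 * cos D.η)
    (hy : D.s ≤ p 1) (hw : 1 ≤ D.c * (p 0 - 1) + D.s * p 1) : p ∈ D.free := by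
  intro q hq
  refine ⟨D.ball_subset_dome hp hq, Or.inr ?_⟩
  rw [Metric.mem_ball, dist_comm, dist_lt_iff one_pos] at hq
  have h1 := unit_combination_le D.c_sq_add zero_le_one hq.le
  have h2 : q 0 ≤ |q 0| := le_abs_self _
  have hc := D.c_pos
  refine ⟨?_, ?_⟩
  · rw [h]
    nlinarith
  · nlinarith

/-- By `hw`, `p` lies on or above the line from the tip in direction `(c, s)`, so among the
obstacles at the lower right only the tip matters. -/
theorem mem_free_upper {p : Plane} (hp : ∀ k ≤ D.N, D.height k p ≤ 2 * cos D.η)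
    (hx : 0 ≤ p 0) (hy : 0 ≤ p 1) (htip : 1 ≤ (p 0 - 1) ^ 2 + p 1 ^ 2)
    (hw : D.s * (p 0 - 1) ≤ D.c * p 1) : p ∈ D.free := by
  intro q hq
  refine ⟨D.ball_subset_dome hp hq, ?_⟩
  rw [Metric.mem_ball, dist_lt_iff one_pos] at hq
  have hL := D.hL
  have hc := D.c_pos
  have hs := D.s_pos
  have hcs := D.c_sq_add
  have hq1 : p 1 - 1 < q 1 := by nlinarith
  rcases le_or_gt (|q 0|) 1 with h1 | h1
  · exact Or.inl ⟨h1, by linarith⟩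
  have hq0 : 1 < q 0 := by
    rcases lt_abs.1 h1 with h | h
    · exact h
    · nlinarith
  refine Or.inr ?_
  rw [basin, Set.mem_ofPred_eq, abs_of_pos (by linarith)]
  rcases le_or_gt 0 (q 1) with h2 | h2
  · have := D.h_neg
    have := mul_pos hc (sub_pos.2 hq0)
    exact ⟨by linarith, by positivity⟩
  -- Seen from the tip, `p` is at distance at least 1 and `q` is within 1 of `p`, so the two
  -- directions form an acute angle.
  have hdot : 0 < (q 0 - 1) * (p 0 - 1) + q 1 * p 1 := by nlinarith
  have hp0 : 0 < p 0 - 1 := by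
    by_contra! h
    nlinarith
  have hps : D.s ≤ p 1 := by
    apply le_of_sq_le_sq _ hy
    have : (D.s * (p 0 - 1)) ^ 2 ≤ (D.c * p 1) ^ 2 :=
      pow_le_pow_left₀ (by positivity) hw 2
    nlinarith
  refine ⟨by unfold h; linarith, ?_⟩
  have h3 : 0 < (D.c * (q 0 - 1) + D.s * q 1) * (p 0 - 1) := by
    nlinarith [mul_pos hc hdot]
  exact (pos_of_mul_pos_left h3 hp0.le).le

/-- The arc of radius one about the right tip of the corridor. -/
def arc : Set Plane := (fun θ : ℝ => pt (1 + cos θ) (sin θ)) '' Set.Icc (2 * D.η) π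

theorem two_mul_η_lt : 0 < 2 * D.η ∧ 2 * D.η < π / 2 := by
  have := D.η_pos; have := D.η_le; have := pi_pos
  constructor <;> linarith

theorem cos_le_c {θ : ℝ} (h1 : 2 * D.η ≤ θ) (h2 : θ ≤ π) : cos θ ≤ D.c :=
  cos_le_cos_of_nonneg_of_le_pi D.two_mul_η_lt.1.le h2 h1

/-- The squared norm is `2 + 2 cos θ`, at most `2 + 2 c = (2 cos η) ^ 2`. -/
theorem height_arc_le {θ : ℝ} (h1 : 2 * D.η ≤ θ) (h2 : θ ≤ π) (k : ℕ) :
    D.height k (pt (1 + cos θ) (sin θ)) ≤ 2 * cos D.η := by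
  apply D.height_le_of_sq_le
  rw [pt_zero, pt_one]
  have h3 : D.c = 2 * cos D.η ^ 2 - 1 := cos_two_mul _
  have := D.cos_le_c h1 h2
  nlinarith [cos_sq_add_sin_sq θ]

theorem arc_subset_free : D.arc ⊆ D.free := by
  rintro _ ⟨θ, ⟨h1, h2⟩, rfl⟩
  have h0 := D.two_mul_η_lt
  apply D.mem_free_upper (fun k _ => D.height_arc_le h1 h2 k)
  · rw [pt_zero]; linarith [neg_one_le_cos θ]
  · rw [pt_one]; exact sin_nonneg_of_nonneg_of_le_pi (by linarith) h2
  · rw [pt_zero, pt_one]; linarith [cos_sq_add_sin_sq θ]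
  · have h3 : 0 ≤ sin (θ - 2 * D.η) :=
      sin_nonneg_of_nonneg_of_le_pi (by linarith) (by linarith)
    rw [sin_sub] at h3
    rw [pt_zero, pt_one, c, s]
    linarith

theorem isPreconnected_arc : IsPreconnected D.arc :=
  isPreconnected_Icc.image _ (continuous_pt (by fun_prop) (by fun_prop)).continuousOn

theorem zero_mem_arc : pt 0 0 ∈ D.arc :=
  ⟨π, ⟨by linarith [D.two_mul_η_lt], le_rfl⟩, by simp⟩

/-- The start position in the right half of the chamber. -/
noncomputable def startPt : Plane := pt (1 + D.c) D.s

theorem startPt_mem_arc : D.startPt ∈ D.arc :=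
  ⟨2 * D.η, ⟨le_rfl, by linarith [D.two_mul_η_lt, pi_pos]⟩, rfl⟩

/-- Beyond the line from the tip in direction `(c, s)`, being free forces the convex conditions of
`mem_free_cap`. The segment to the start is thus free, and the arc continues to the origin. -/
theorem exists_preconnected_cap {p : Plane} (hp : p ∈ D.free) (hy : 0 < p 1)
    (hw : D.c * p 1 < D.s * (p 0 - 1)) :
    ∃ t ⊆ D.free, pt 0 0 ∈ t ∧ p ∈ t ∧ IsPreconnected t := by
  have hc := D.c_pos
  have hs := D.s_pos
  have hcs := D.c_sq_add
  have hx : 0 < p 0 - 1 := by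
    by_contra! hle
    nlinarith [mul_pos hc hy]
  have h1 : D.s ≤ p 1 := by
    have h := D.one_le_dist_of_right (q := pt (p 0) D.h) hp (by simp; linarith) (Or.inr (by simp))
    rw [le_dist_iff one_pos, pt_zero, pt_one] at h
    have := D.h_neg
    have e : D.h = D.s - 1 := rfl
    nlinarith
  have h2 : 1 ≤ D.c * (p 0 - 1) + D.s * p 1 := by
    -- The foot of the perpendicular from `p` to the slanted line is the tip plus `t (s, -c)`; `t >
    -- 0` puts it on the obstacle side.
    obtain ⟨t, ht⟩ : ∃ t, t = D.s * (p 0 - 1) - D.c * p 1 := ⟨_, rfl⟩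
    have ht0 : 0 < t := by linarith
    have h := D.one_le_dist_of_right (q := pt (1 + t * D.s) (-(t * D.c))) hp
      (by rw [pt_zero]; nlinarith) (Or.inl (by rw [pt_zero, pt_one]; linarith))
    rw [le_dist_iff one_pos, pt_zero, pt_one] at h
    have e : (1 + t * D.s - p 0) ^ 2 + (-(t * D.c) - p 1) ^ 2 =
        (D.c * (p 0 - 1) + D.s * p 1) ^ 2 + (D.c ^ 2 + D.s ^ 2 - 1) *
        (t ^ 2 - (p 0 - 1) ^ 2 - p 1 ^ 2) := by
      rw [ht]; ring
    rw [e, hcs] at h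
    have : 0 < D.c * (p 0 - 1) + D.s * p 1 := by positivity
    nlinarith
  refine ⟨segment ℝ p D.startPt ∪ D.arc, ?_, Or.inr D.zero_mem_arc, Or.inl (left_mem_segment _ _ _),
    IsPreconnected.union D.startPt (right_mem_segment _ _ _) D.startPt_mem_arc
      (convex_segment _ _).isPreconnected D.isPreconnected_arc⟩
  refine Set.union_subset (fun q hq => ?_) D.arc_subset_free
  obtain ⟨t, ht0, ht1, e0, e1⟩ := mem_segment_iff.1 hq
  rw [startPt, pt_zero] at e0
  rw [startPt, pt_one] at e1
  apply D.mem_free_cap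
  · intro k hk
    have g1 := D.height_le_of_mem_free hp hk
    have g2 := D.height_le_of_mem_free (D.arc_subset_free D.startPt_mem_arc) hk
    have : D.height k q = (1 - t) * D.height k p + t * D.height k D.startPt := by
      simp only [height, e0, e1, startPt, pt_zero, pt_one]; ring
    rw [this]
    nlinarith
  · rw [e1]; nlinarith
  · rw [e0, e1]; nlinarith

/-- Move radially towards the tip until at distance 1 from it, then follow the arc. -/
theorem exists_preconnected_upper {p : Plane} (hp : p ∈ D.free) (hx : 0 ≤ p 0) (hy : 0 < p 1)
    (hw : D.s * (p 0 - 1) ≤ D.c * p 1) :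
    ∃ t ⊆ D.free, pt 0 0 ∈ t ∧ p ∈ t ∧ IsPreconnected t := by
  have hη := D.two_mul_η_lt
  have htip : 1 ≤ (p 0 - 1) ^ 2 + p 1 ^ 2 := by
    have h := D.one_le_dist_of_right (q := pt 1 0) hp (by simp) (Or.inl (by simp))
    rw [le_dist_iff one_pos, pt_zero, pt_one] at h
    linarith
  obtain ⟨r, α, hr, hα0, hαπ, ex, ey⟩ := exists_polar (x := p 0 - 1) hy.le
  have ex' : p 0 = 1 + r * cos α := by linarith
  have hr1 : 1 ≤ r := by
    rw [ex, ey] at htip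
    have e : (r * cos α) ^ 2 + (r * sin α) ^ 2 = r ^ 2 := by
      linear_combination r ^ 2 * cos_sq_add_sin_sq α
    nlinarith
  have hα : 2 * D.η ≤ α := by
    by_contra! hlt
    have h := sin_pos_of_pos_of_lt_pi (x := 2 * D.η - α) (by linarith) (by linarith)
    rw [sin_sub] at h
    rw [ex, ey, c, s] at hw
    nlinarith
  have hw' : D.s * cos α ≤ D.c * sin α := by
    rw [ex, ey] at hw
    nlinarith
  refine ⟨(fun l : ℝ => pt (1 + l * cos α) (l * sin α)) '' Set.Icc 1 r ∪ D.arc, ?_,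
    Or.inr D.zero_mem_arc, Or.inl ⟨r, ⟨hr1, le_rfl⟩, plane_ext (by simp [ex']) (by simp [ey])⟩,
    IsPreconnected.union (pt (1 + cos α) (sin α)) ⟨1, ⟨le_rfl, hr1⟩, by simp⟩ ⟨α, ⟨hα, hαπ⟩, rfl⟩
      (isPreconnected_Icc.image _ (continuous_pt (by fun_prop) (by fun_prop)).continuousOn)
      D.isPreconnected_arc⟩
  refine Set.union_subset ?_ D.arc_subset_free
  rintro _ ⟨l, ⟨hl1, hlr⟩, rfl⟩
  have hsin := sin_nonneg_of_nonneg_of_le_pi hα0 hαπ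
  apply D.mem_free_upper
  · intro k hk
    have g1 := D.height_le_of_mem_free hp hk
    have g2 := D.height_arc_le hα hαπ k
    simp only [height, pt_zero, pt_one, ex', ey] at g1 g2 ⊢
    -- The height is affine in `l`, so its bounds at `l = 1` and `l = r` suffice.
    rcases le_total 0 (cos (k * D.η) * cos α + sin (k * D.η) * sin α) with h | h <;> nlinarith
  · rw [pt_zero]
    have := neg_one_le_cos α
    rcases le_total 0 (cos α) with h | h <;> nlinarith
  · rw [pt_one]; positivity
  · rw [pt_zero, pt_one]
    have e : (1 + l * cos α - 1) ^ 2 + (l * sin α) ^ 2 = l ^ 2 := by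
      linear_combination l ^ 2 * cos_sq_add_sin_sq α
    nlinarith
  · rw [pt_zero, pt_one]
    nlinarith

theorem exists_preconnected_right {p : Plane} (hp : p ∈ D.free) (hx : 0 ≤ p 0) (hy : 0 < p 1) :
    ∃ t ⊆ D.free, pt 0 0 ∈ t ∧ p ∈ t ∧ IsPreconnected t := by
  rcases le_or_gt (D.s * (p 0 - 1)) (D.c * p 1) with h | h
  · exact D.exists_preconnected_upper hp hx hy h
  · exact D.exists_preconnected_cap hp hy h

theorem neg_L_le_of_mem_free {p : Plane} (hp : p ∈ D.free) : 1 - D.L ≤ p 1 := by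
  have h := D.mem_region_of_dist_le (q := pt (p 0) (p 1 - 1)) hp
    (by rw [dist_eq_sqrt]; simp)
  have := D.neg_L_lt
  rcases h.2 with h | h
  · have := h.2
    rw [pt_one] at this
    linarith
  · have := h.1
    rw [pt_one] at this
    linarith

theorem isConnected_free : IsConnected D.free := by
  refine ⟨⟨_, D.arc_subset_free D.zero_mem_arc⟩, isPreconnected_of_forall (pt 0 0) fun p hp => ?_⟩
  rcases le_or_gt (p 1) 0 with hy | hy
  · have hx := D.eq_zero_of_mem_free_of_nonpos hp hy
    have hL := D.neg_L_le_of_mem_free hp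
    refine ⟨segment ℝ (pt 0 0) p, fun q hq => ?_, left_mem_segment _ _ _, right_mem_segment _ _ _,
      (convex_segment _ _).isPreconnected⟩
    obtain ⟨t, h0, h1, e0, e1⟩ := mem_segment_iff.1 hq
    rw [pt_zero] at e0
    rw [pt_one] at e1
    exact D.mem_free_corridor (by rw [e0, hx]; ring) (by rw [e1]; nlinarith) (by rw [e1]; nlinarith)
  · rcases le_total 0 (p 0) with hx | hx
    · exact D.exists_preconnected_right hp hx hy
    · obtain ⟨t, h1, h2, h3, h4⟩ := D.exists_preconnected_right (p := mirror p)
        (D.mirror_mem_free hp) (by simpa using hx) (by simpa using hy)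
      refine ⟨mirror '' t, ?_, ⟨_, h2, plane_ext (by simp) (by simp)⟩, ⟨_, h3, mirror_mirror p⟩,
        h4.image _ continuous_mirror.continuousOn⟩
      rintro _ ⟨q, hq, rfl⟩
      exact D.mirror_mem_free (h1 hq)

end Flask

/-! ### Choice of the parameters and conclusion. -/

theorem exists_unsolvable_instance {μ : ℝ} (β : ℝ) (hμ : μ < 4) :
    ∃ (n : ℕ) (P : Polygon Plane n) (S T : Finset Plane),
      IsSimplePolygon P ∧ IsConnected (freeSpace (workspace P)) ∧
      (S : Set Plane) ⊆ freeSpace (workspace P) ∧ (T : Set Plane) ⊆ freeSpace (workspace P) ∧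
      S.card = 2 ∧ T.card = 2 ∧ MonochromaticSeparation μ S T ∧ BichromaticSeparation β S T ∧
      ¬ Solvable (freeSpace (workspace P)) S T := by
  obtain ⟨N, hN8, hN⟩ : ∃ N : ℕ, 8 ≤ N ∧ μ < 2 * (1 + cos (2 * (π / N))) := by
    have h1 : Filter.Tendsto (fun N : ℕ => 2 * (1 + cos (2 * (π / N)))) Filter.atTop
        (nhds (2 * (1 + cos (2 * 0)))) := by
      have h0 : Filter.Tendsto (fun N : ℕ => π / (N : ℝ)) Filter.atTop (nhds 0) :=
        tendsto_const_div_atTop_nhds_zero_nat π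
      have hc : Continuous fun x : ℝ => 2 * (1 + cos (2 * x)) := by fun_prop
      exact (hc.tendsto 0).comp h0
    have h2 : μ < 2 * (1 + cos (2 * 0)) := by norm_num; linarith
    exact ((Filter.eventually_ge_atTop 8).and (h1.eventually_const_lt h2)).exists
  obtain ⟨l, hl1, hlβ⟩ : ∃ l : ℝ, 1 ≤ l ∧ β ≤ l := ⟨max 1 β, le_max_left _ _, le_max_right _ _⟩
  -- The targets sit at depths `l` and `l + 4`; length `l + 5` leaves a unit of room below the
  -- deeper one.
  let D : Flask := ⟨N, l + 5, hN8, by linarith⟩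
  have hDc : μ < 2 * (1 + D.c) := hN
  have hc := D.c_pos
  have hs := D.s_pos
  have hST : D.startPt ≠ mirror D.startPt := fun h => by
    have := congrArg (· 0) h
    simp only [mirror_zero, Flask.startPt, pt_zero] at this
    linarith
  have hTT : pt 0 (-l) ≠ pt 0 (-(l + 4)) := fun h => by
    have := congrArg (· 1) h
    simp only [pt_one] at this
    linarith
  have hstart := D.arc_subset_free D.startPt_mem_arc
  have hSdist : μ ≤ dist D.startPt (mirror D.startPt) := by
    refine hDc.le.trans ((le_dist_iff (by linarith)).2 ?_)
    simp only [Flask.startPt, mirror_zero, mirror_one, pt_zero, pt_one]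
    nlinarith
  have hTdist : μ ≤ dist (pt 0 (-l)) (pt 0 (-(l + 4))) := by
    refine hμ.le.trans ((le_dist_iff (by norm_num)).2 ?_)
    simp only [pt_zero, pt_one]
    nlinarith
  have hSy : ∀ p ∈ ({D.startPt, mirror D.startPt} : Finset Plane), p 1 = D.s := by
    intro p hp
    rcases Finset.mem_insert.1 hp with rfl | hp
    · simp [Flask.startPt]
    · rw [Finset.mem_singleton.1 hp]; simp [Flask.startPt]
  have hTy : ∀ p ∈ ({pt 0 (-l), pt 0 (-(l + 4))} : Finset Plane), p 1 ≤ -l := by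
    intro p hp
    rcases Finset.mem_insert.1 hp with rfl | hp
    · simp
    · rw [Finset.mem_singleton.1 hp]; simp
  have separated_pair : ∀ {p q : Plane}, μ ≤ dist p q → Separated μ {p, q} := by
    intro p q h x hx y hy hne
    simp only [Finset.mem_insert, Finset.mem_singleton] at hx hy
    rcases hx with rfl | rfl <;> rcases hy with rfl | rfl
    · exact (hne rfl).elim
    · exact h
    · rwa [dist_comm]
    · exact (hne rfl).elim
  refine ⟨_, D.outline, {D.startPt, mirror D.startPt}, {pt 0 (-l), pt 0 (-(l + 4))},
    D.isSimplePolygon_outline, ?_⟩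
  rw [D.freeSpace_outline]
  refine ⟨D.isConnected_free, ?_, ?_, Finset.card_pair hST, Finset.card_pair hTT,
    ⟨separated_pair hSdist, separated_pair hTdist⟩, ?_, ?_⟩
  · rw [Finset.coe_pair]
    exact Set.pair_subset hstart (D.mirror_mem_free hstart)
  · have hL : D.L = l + 5 := rfl
    rw [Finset.coe_pair]
    exact Set.pair_subset
      (D.mem_free_corridor (by simp) (by rw [pt_one]; linarith) (by rw [pt_one]; linarith))
      (D.mem_free_corridor (by simp) (by rw [pt_one]; linarith) (by rw [pt_one]; linarith))
  · intro p hp q hq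
    have h1 := hSy p hp
    have h2 := hTy q hq
    refine hlβ.trans ((le_dist_iff (by linarith)).2 ?_)
    nlinarith [sq_nonneg (p 0 - q 0)]
  · refine D.not_solvable (by rw [Finset.card_pair hST]; norm_num) (fun p hp => ?_)
      (fun p hp => ?_)
    · rw [hSy p hp]; exact hs
    · linarith [hTy p hp]

end MRMP

theorem mainTheorem4 :
    (∀ μ β : ℝ, μ < 4 →
      ∃ (n : ℕ) (P : Polygon MRMP.Plane n) (S T : Finset MRMP.Plane),
        MRMP.IsSimplePolygon P ∧
        IsConnected (MRMP.freeSpace (MRMP.workspace P)) ∧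
        (S : Set MRMP.Plane) ⊆ MRMP.freeSpace (MRMP.workspace P) ∧
        (T : Set MRMP.Plane) ⊆ MRMP.freeSpace (MRMP.workspace P) ∧
        S.card = 2 ∧ T.card = 2 ∧
        MRMP.MonochromaticSeparation μ S T ∧
        MRMP.BichromaticSeparation β S T ∧
        ¬ MRMP.Solvable (MRMP.freeSpace (MRMP.workspace P)) S T) ∧
    (∀ μ β : ℝ, MRMP.SeparationSuffices μ β → 4 ≤ μ) := by
  refine ⟨fun μ β hμ => MRMP.exists_unsolvable_instance β hμ, fun μ β h => ?_⟩
  by_contra! hμ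
  obtain ⟨n, P, S, T, hP, hF, hS, hT, hS2, hT2, hmono, hbi, hno⟩ :=
    MRMP.exists_unsolvable_instance β hμ
  exact hno (h n P hP hF S T hS hT (hS2.trans hT2.symm) hmono hbi)
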